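/- A function $\varphi:[0,\infty)\to[0,\infty]$ is an Orlicz function if it is convex, non-decreasing and left continuous on $(0,\infty)$, $\varphi(0)=0$, and $\varphi$ is neither identically $0$ nor identically $\infty$ on $(0,\infty)$. Let $I=[0,1]$ or $I=[0,\infty)$, let $L^0(I)$ be the space of (a.e.-equivalence classes of) Lebesgue measurable real functions on $I$, and let $$L^\varphi(I)=\Big\{f\in L^0(I):\int_I\varphi(|f(t)|/\lambda)\,dt<\infty\text{ for some }\lambda>0\Big\},\qquad \|f\|_\varphi=\inf\Big\{\lambda>0:\int_I\varphi(|f(t)|/\lambda)\,dt\le1\Big\}.$$ Let $Cf(x)=\frac1x\int_0^xf(t)\,dt$ for $0<x\in I$ (the Cesàro operator), and let $Ces_\varphi=\{f\in L^0(I):C|f|\in L^\varphi(I)\}$ with the norm $\|f\|_{Ces(\varphi)}=\|C|f|\,\|_\varphi$. Theorem. Let $\varphi$ be an Orlicz function and suppose that $C$ maps $L^\varphi(I)$ into $L^\varphi(I)$ (in particular, this holds whenever $C$ is bounded on $L^\varphi(I)$). Then the following conditions are equivalent: (i) $\varphi\in\Delta_2$, that is: if $I=[0,1]$, there are $K>0$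 and $u_0>0$ with $\varphi(u_0)<\infty$ and $\varphi(2u)\le K\varphi(u)$ for all $u\ge u_0$; if $I=[0,\infty)$, there is $K>0$ with $\varphi(2u)\le K\varphi(u)$ for all $u\ge0$; (ii) $Ces_\varphi$ is order continuous, that is, for every $f\in Ces_\varphi$ and every sequence $(f_n)$ in $Ces_\varphi$ with $0\le f_n\le|f|$ and $f_n\to0$ a.e. on $I$, one has $\|f_n\|_{Ces(\varphi)}\to0$; (iii) $Ces_\varphi$ contains no isomorphic copy of $\ell^\infty$, that is, there is no linear map $T:\ell^\infty\to Ces_\varphi$ for which there are constants $a,b>0$ with $a\|x\|_\infty\le\|Tx\|_{Ces(\varphi)}\le b\|x\|_\infty$ for all $x\in\ell^\infty$. -/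

import Mathlib

open MeasureTheory Set Filter Topology
open scoped NNReal ENNReal

noncomputable section

namespace CesaroOrlicz

/-- Orlicz functions `φ : [0,∞) → [0,∞]`. -/
structure IsOrlicz (φ : ℝ≥0 → ℝ≥0∞) : Prop where
  convex : ConvexOn ℝ≥0 univ φ
  mono : Monotone φ
  map_zero : φ 0 = 0
  not_zero : ∃ u, 0 < u ∧ φ u ≠ 0
  not_top : ∃ u, 0 < u ∧ φ u ≠ ∞
  left_cont : ∀ u, 0 < u → ContinuousWithinAt φ (Iio u) u

/-- The condition `Δ₂` for large arguments. -/
def Delta2Infty (φ : ℝ≥0 → ℝ≥0∞) : Prop :=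
  ∃ K u₀ : ℝ≥0, 0 < K ∧ 0 < u₀ ∧ φ u₀ < ∞ ∧ ∀ u, u₀ ≤ u → φ (2 * u) ≤ K * φ u

/-- The condition `Δ₂` for all arguments. -/
def Delta2All (φ : ℝ≥0 → ℝ≥0∞) : Prop :=
  ∃ K : ℝ≥0, 0 < K ∧ ∀ u, φ (2 * u) ≤ K * φ u

/-- The extension of `φ` to `[0,∞]` by `φ(∞) = ∞`. With it, a `[0,∞]`-valued function whose
modular is finite is automatically finite almost everywhere. -/
def ext (φ : ℝ≥0 → ℝ≥0∞) (u : ℝ≥0∞) : ℝ≥0∞ :=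
  if u = ∞ then ∞ else φ u.toNNReal

/-- The modular `I_φ(g) = ∫_I φ(g(t)) dt` of a nonnegative function `g`. -/
def modular (φ : ℝ≥0 → ℝ≥0∞) (I : Set ℝ) (g : ℝ → ℝ≥0∞) : ℝ≥0∞ :=
  ∫⁻ t in I, ext φ (g t)

/-- The Luxemburg-Nakano norm `inf {λ > 0 : I_φ(g/λ) ≤ 1}` of a nonnegative function `g`. -/
def luxNorm (φ : ℝ≥0 → ℝ≥0∞) (I : Set ℝ) (g : ℝ → ℝ≥0∞) : ℝ :=
  sInf {l : ℝ | 0 < l ∧ modular φ I (fun t => g t / ENNReal.ofReal l) ≤ 1}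

/-- `f` belongs to the Orlicz space `L^φ(I)`. -/
def MemOrlicz (φ : ℝ≥0 → ℝ≥0∞) (I : Set ℝ) (f : ℝ → ℝ) : Prop :=
  AEStronglyMeasurable f (volume.restrict I) ∧
    ∃ l : ℝ, 0 < l ∧ modular φ I (fun t => ‖f t‖ₑ / ENNReal.ofReal l) < ∞

/-- The Cesàro operator `C f (x) = (1/x) ∫_0^x f(t) dt`. (Elements of an Orlicz space
are integrable on bounded intervals.) -/
def cesaro (f : ℝ → ℝ) (x : ℝ) : ℝ :=
  (1 / x) * ∫ t in (0 : ℝ)..x, f t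

/-- The Cesàro mean `C|f|(x) = (1/x) ∫_0^x |f(t)| dt`, with value `∞` where the integral
diverges. -/
def cesaroAbs (f : ℝ → ℝ) (x : ℝ) : ℝ≥0∞ :=
  (∫⁻ t in Ioc 0 x, ‖f t‖ₑ) / ENNReal.ofReal x

/-- The space `L⁰(I)` of classes of Lebesgue measurable real functions on `I`. -/
abbrev L0 (I : Set ℝ) : Type := ℝ →ₘ[volume.restrict I] ℝ

/-- The Cesàro-Orlicz space `Ces_φ(I) = {f ∈ L⁰(I) : C|f| ∈ L^φ(I)}`. -/
def Ces (φ : ℝ≥0 → ℝ≥0∞) (I : Set ℝ) : Set (L0 I) :=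
  {f | ∃ l : ℝ, 0 < l ∧ modular φ I (fun x => cesaroAbs f x / ENNReal.ofReal l) < ∞}

/-- The norm `‖f‖ = ‖C|f|‖_φ` of `Ces_φ(I)`. -/
def cesNorm (φ : ℝ≥0 → ℝ≥0∞) (I : Set ℝ) (f : L0 I) : ℝ :=
  luxNorm φ I (cesaroAbs f)

/-- Order continuity of an ideal space `E ⊆ L⁰(I)` with norm `N`: every `f ∈ E` is an order
continuous element. -/
def IsOrderContinuous {I : Set ℝ} (E : Set (L0 I)) (N : L0 I → ℝ) : Prop :=
  ∀ f ∈ E, ∀ g : ℕ → L0 I, (∀ n, g n ∈ E) → (∀ n, 0 ≤ g n ∧ g n ≤ |f|) →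
    (∀ᵐ t ∂(volume.restrict I), Tendsto (fun n => g n t) atTop (𝓝 0)) →
    Tendsto (fun n => N (g n)) atTop (𝓝 0)

/-- The space `E ⊆ L⁰(I)` with norm `N` contains an isomorphic copy of `ℓ^∞`: there is
a linear map from `ℓ^∞` into `E` that is an isomorphism of normed spaces onto its range. -/
def ContainsLinfty {I : Set ℝ} (E : Set (L0 I)) (N : L0 I → ℝ) : Prop :=
  ∃ T : lp (fun _ : ℕ => ℝ) ∞ →ₗ[ℝ] L0 I, (∀ x, T x ∈ E) ∧
    ∃ a b : ℝ, 0 < a ∧ 0 < b ∧ ∀ x, a * ‖x‖ ≤ N (T x) ∧ N (T x) ≤ b * ‖x‖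

end CesaroOrlicz

end

/-! (i) ⇒ (ii): `Δ₂` keeps a finite modular finite under every dilation, so `C|f|/ε` has finite
modular for each `ε > 0`. Dominated convergence inside each Cesàro mean, then inside the modular,
sends the modular of `C|f_n|/ε` to zero (`IsUnitOrHalfLine.isOrderContinuous`).

(ii) ⇒ (iii): given an embedding `T` of `ℓ^∞`, average `|∑ ± T e_k|` over all signs. By convexity
these means are bounded in `Ces_φ`, and they increase with the number of terms, so by the Fatou
property their supremum `G` lies in `Ces_φ`. It dominates every `|T e_k|`, and where it is finite
Khintchine's inequality makes `T e_k(t)` square summable, so `T e_k → 0` a.e. Order continuity then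
contradicts `‖T e_k‖ ≥ a` (`IsUnitOrHalfLine.not_containsLinfty`).

(iii) ⇒ (i): without `Δ₂` there are heights `u_n` and lengths `t_n` with `∑ φ(u_n) t_n < ∞` but `φ(c
u_n) t_n ≥ 4`. The supremum of the steps `u_n` on `(0, t_n]` lies in `L^φ`, hence in `Ces_φ` by the
hypothesis on `C`, while its tails near `0` or near `∞` stay large in norm
(`containsLinfty_of_stairs`). Cutting it into disjoint blocks of large norm and multiplying the
blocks by the terms of a sequence embeds `ℓ^∞` (`containsLinfty_of_tails`). -/

namespace CesaroOrlicz

variable {φ : ℝ≥0 → ℝ≥0∞} {I : Set ℝ}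

/-! ### Convexity, growth and semicontinuity of Orlicz functions -/

section Ext

lemma ext_coe (φ : ℝ≥0 → ℝ≥0∞) (u : ℝ≥0) : ext φ u = φ u := by
  simp [ext]

lemma ext_top (φ : ℝ≥0 → ℝ≥0∞) : ext φ ∞ = ∞ := by
  simp [ext]

lemma IsOrlicz.ext_zero (hφ : IsOrlicz φ) : ext φ 0 = 0 := by
  simp [ext, hφ.map_zero]

lemma IsOrlicz.ext_mono (hφ : IsOrlicz φ) : Monotone (ext φ) := by
  intro u v huv
  induction v with
  | top => simp [ext_top]
  | coe v =>
    lift u to ℝ≥0 using ne_top_of_le_ne_top ENNReal.coe_ne_top huv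
    rw [ext_coe, ext_coe]
    exact hφ.mono (by exact_mod_cast huv)

lemma IsOrlicz.measurable_ext (hφ : IsOrlicz φ) : Measurable (ext φ) :=
  hφ.ext_mono.measurable

lemma IsOrlicz.map_mul_le (hφ : IsOrlicz φ) {t : ℝ≥0} (ht : t ≤ 1) (u : ℝ≥0) :
    φ (t * u) ≤ t * φ u := by
  have h := hφ.convex.2 (mem_univ u) (mem_univ 0) zero_le zero_le
    (add_tsub_cancel_of_le ht)
  simpa [hφ.map_zero, ENNReal.smul_def] using h

lemma IsOrlicz.ext_mul_le (hφ : IsOrlicz φ) {t : ℝ≥0} (ht : t ≤ 1) (v : ℝ≥0∞) :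
    ext φ (t * v) ≤ t * ext φ v := by
  rcases eq_or_ne t 0 with rfl | h0
  · simp [hφ.ext_zero]
  induction v with
  | top => simp [ext_top, h0]
  | coe v =>
    rw [← ENNReal.coe_mul, ext_coe, ext_coe]
    exact hφ.map_mul_le ht v

lemma IsOrlicz.ext_add_div_two_le (hφ : IsOrlicz φ) (u v : ℝ≥0∞) :
    ext φ ((u + v) / 2) ≤ (ext φ u + ext φ v) / 2 := by
  induction u with
  | top => simp [ext_top, ENNReal.top_div]
  | coe u =>
    induction v with
    | top => simp [ext_top, ENNReal.top_div]
    | coe v =>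
      have h := hφ.convex.2 (mem_univ u) (mem_univ v) zero_le
        zero_le (show (2⁻¹ : ℝ≥0) + 2⁻¹ = 1 by rw [← two_mul]; norm_num)
      have e : ((u : ℝ≥0∞) + v) / 2 = ((2⁻¹ * u + 2⁻¹ * v : ℝ≥0) : ℝ≥0∞) := by
        push_cast
        rw [ENNReal.div_eq_inv_mul, mul_add]
      rw [e, ext_coe, ext_coe, ext_coe, ENNReal.div_eq_inv_mul, mul_add]
      simpa [ENNReal.smul_def, ENNReal.coe_inv] using h

/-- An Orlicz function grows at least linearly. -/
lemma IsOrlicz.exists_le_add_mul (hφ : IsOrlicz φ) :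
    ∃ a b : ℝ≥0, 0 < b ∧ ∀ v, v ≤ a + b * ext φ v := by
  obtain ⟨u, hu, hφu⟩ := hφ.not_zero
  obtain ⟨c, hc0, hc⟩ : ∃ c : ℝ≥0, 0 < c ∧ (c : ℝ≥0∞) ≤ φ u := by
    obtain ⟨c, hc0, hc⟩ := ENNReal.lt_iff_exists_nnreal_btwn.1 (pos_iff_ne_zero.2 hφu)
    exact ⟨c, by exact_mod_cast hc0, hc.le⟩
  refine ⟨u, u / c, by positivity, fun v => ?_⟩
  induction v with
  | top =>
    have : (u / c) ≠ 0 := by positivity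
    rw [ext_top, ENNReal.mul_top (by exact_mod_cast this)]
    simp
  | coe v =>
    rw [ext_coe]
    rcases le_total v u with h | h
    · exact le_add_right (by exact_mod_cast h)
    · refine le_add_left ?_
      have hv : 0 < v := hu.trans_le h
      -- `u` lies between `0` and `v`, so the chord from the origin gives `φ u ≤ (u / v) φ v`.
      have h1 := hφ.map_mul_le (t := u / v) (div_le_one_of_le₀ h zero_le) v
      rw [div_mul_cancel₀ _ hv.ne'] at h1
      have h2 : (c : ℝ≥0∞) ≤ (u / v : ℝ≥0) * φ v := hc.trans h1
      calc (v : ℝ≥0∞) = (v / c : ℝ≥0) * c := by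
            rw [← ENNReal.coe_mul, div_mul_cancel₀ _ hc0.ne']
        _ ≤ (v / c : ℝ≥0) * ((u / v : ℝ≥0) * φ v) := by gcongr
        _ = (u / c : ℝ≥0) * φ v := by
            rw [← mul_assoc, ← ENNReal.coe_mul]
            congr 2
            field_simp

/-- At finite points this is left continuity; at `∞` it is linear growth, which excludes a finite
bound. It is the source of the Fatou property. -/
lemma IsOrlicz.ext_le_of_forall_lt (hφ : IsOrlicz φ) {v M : ℝ≥0∞}
    (h : ∀ w < v, ext φ w ≤ M) : ext φ v ≤ M := by
  induction v with
  | top =>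
    obtain ⟨a, b, hb, hab⟩ := hφ.exists_le_add_mul
    by_contra hM
    have hM' : M ≠ ∞ := by rintro rfl; simp at hM
    have hlt : (a : ℝ≥0∞) + b * M < ∞ := by finiteness
    obtain ⟨w, hw1, hw2⟩ := exists_between hlt
    exact absurd (hab w) (not_le.2 (lt_of_le_of_lt (by gcongr; exact h w hw2) hw1))
  | coe v =>
    rw [ext_coe]
    rcases eq_or_ne v 0 with rfl | hv
    · simp [hφ.map_zero]
    have hv' : 0 < v := pos_iff_ne_zero.2 hv
    have : (𝓝[<] v).NeBot := nhdsLT_neBot_of_exists_lt ⟨0, hv'⟩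
    refine le_of_tendsto (hφ.left_cont v hv') ?_
    filter_upwards [self_mem_nhdsWithin] with w hw
    rw [← ext_coe φ w]
    exact h w (by exact_mod_cast hw)

lemma IsOrlicz.ext_iSup_le (hφ : IsOrlicz φ) {ι : Sort*} (f : ι → ℝ≥0∞) :
    ext φ (⨆ i, f i) ≤ ⨆ i, ext φ (f i) := by
  refine hφ.ext_le_of_forall_lt fun w hw => ?_
  obtain ⟨i, hi⟩ := lt_iSup_iff.1 hw
  exact (hφ.ext_mono hi.le).trans (le_iSup (fun i => ext φ (f i)) i)

lemma IsOrlicz.tendsto_ext_zero (hφ : IsOrlicz φ) : Tendsto (ext φ) (𝓝 0) (𝓝 0) := by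
  obtain ⟨u, hu, hφu⟩ := hφ.not_top
  have h1 : Tendsto (fun v : ℝ≥0∞ => v / u * φ u) (𝓝 0) (𝓝 0) := by
    have : Tendsto (fun v : ℝ≥0∞ => v * ((u : ℝ≥0∞)⁻¹ * φ u)) (𝓝 0) (𝓝 (0 * _)) :=
      ENNReal.Tendsto.mul_const tendsto_id
        (Or.inr (ENNReal.mul_ne_top (by simpa using hu.ne') hφu))
    simpa [div_eq_mul_inv, mul_assoc] using this
  refine tendsto_of_tendsto_of_tendsto_of_le_of_le' tendsto_const_nhds h1
    (Eventually.of_forall fun _ => zero_le) ?_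
  filter_upwards [Iic_mem_nhds (show (0 : ℝ≥0∞) < u by exact_mod_cast hu)] with v hv
  lift v to ℝ≥0 using ne_top_of_le_ne_top ENNReal.coe_ne_top hv
  have hv' : v ≤ u := ENNReal.coe_le_coe.1 hv
  have h := hφ.map_mul_le (t := v / u) (div_le_one_of_le₀ hv' zero_le) u
  rw [div_mul_cancel₀ _ hu.ne', ENNReal.coe_div hu.ne'] at h
  rwa [ext_coe]

end Ext

/-! ### The modular and the Luxemburg norm -/

section Modular

lemma IsOrlicz.modular_mono (hφ : IsOrlicz φ) (hI : MeasurableSet I) {g h : ℝ → ℝ≥0∞}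
    (hgh : ∀ t ∈ I, g t ≤ h t) : modular φ I g ≤ modular φ I h :=
  setLIntegral_mono' hI fun t ht => hφ.ext_mono (hgh t ht)

/-- By convexity, shrinking the argument by `1 / (1 + m)` turns a modular `m` into at most `m / (1 +
m)`. Hence the infimum defining the norm is over a nonempty set and is not the default value `0`. -/
lemma IsOrlicz.exists_modular_le_one (hφ : IsOrlicz φ) {g : ℝ → ℝ≥0∞}
    (h : ∃ l : ℝ, 0 < l ∧ modular φ I (fun t => g t / ENNReal.ofReal l) < ∞) :
    ∃ l : ℝ, 0 < l ∧ modular φ I (fun t => g t / ENNReal.ofReal l) ≤ 1 := by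
  obtain ⟨l, hl, hm⟩ := h
  obtain ⟨m, hm_def⟩ : ∃ m : ℝ≥0, (m : ℝ≥0∞) = _ := ⟨_, ENNReal.coe_toNNReal hm.ne⟩
  set s : ℝ≥0 := (1 + m)⁻¹ with hs
  have hs1 : s ≤ 1 := inv_le_one_of_one_le₀ (by simp)
  have hs0 : 0 < s := by positivity
  refine ⟨l / s, by positivity, ?_⟩
  have e : ∀ t, g t / ENNReal.ofReal (l / s) = s * (g t / ENNReal.ofReal l) := by
    intro t
    rw [ENNReal.ofReal_div_of_pos (by exact_mod_cast hs0), ENNReal.ofReal_coe_nnreal]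
    rw [div_eq_mul_inv, ENNReal.inv_div (by simp) (by simp [hs0.ne']), div_eq_mul_inv,
      div_eq_mul_inv]
    ring
  calc modular φ I (fun t => g t / ENNReal.ofReal (l / s))
      ≤ ∫⁻ t in I, s * ext φ (g t / ENNReal.ofReal l) := by
        refine lintegral_mono fun t => ?_
        simp only [e]
        exact hφ.ext_mul_le hs1 _
    _ = s * m := by rw [lintegral_const_mul' _ _ ENNReal.coe_ne_top, hm_def]; rfl
    _ ≤ 1 := by
        rw [← ENNReal.coe_mul, hs]
        norm_cast
        rw [inv_mul_le_one₀ (by positivity)]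
        simp

lemma luxNorm_le {g : ℝ → ℝ≥0∞} {l : ℝ} (hl : 0 < l)
    (h : modular φ I (fun t => g t / ENNReal.ofReal l) ≤ 1) : luxNorm φ I g ≤ l :=
  csInf_le ⟨0, fun _ h => h.1.le⟩ ⟨hl, h⟩

lemma luxNorm_nonneg (g : ℝ → ℝ≥0∞) : 0 ≤ luxNorm φ I g :=
  Real.sInf_nonneg fun _ h => h.1.le

lemma IsOrlicz.le_luxNorm (hφ : IsOrlicz φ) {g : ℝ → ℝ≥0∞} {c : ℝ}
    (h : ∃ l : ℝ, 0 < l ∧ modular φ I (fun t => g t / ENNReal.ofReal l) < ∞)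
    (hc : ∀ l : ℝ, 0 < l → modular φ I (fun t => g t / ENNReal.ofReal l) ≤ 1 → c ≤ l) :
    c ≤ luxNorm φ I g :=
  le_csInf (hφ.exists_modular_le_one h) fun l hl => hc l hl.1 hl.2

lemma IsOrlicz.modular_le_one_of_luxNorm_lt (hφ : IsOrlicz φ) {g : ℝ → ℝ≥0∞} {l : ℝ}
    (h : ∃ l : ℝ, 0 < l ∧ modular φ I (fun t => g t / ENNReal.ofReal l) < ∞)
    (hl : luxNorm φ I g < l) : modular φ I (fun t => g t / ENNReal.ofReal l) ≤ 1 := by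
  obtain ⟨m, ⟨-, hm1⟩, hml⟩ := exists_lt_of_csInf_lt (hφ.exists_modular_le_one h) hl
  refine le_trans (lintegral_mono fun t => hφ.ext_mono ?_) hm1
  dsimp only
  gcongr

end Modular

/-! ### Cesàro means of nonnegative functions -/

section CesMean

/-- The Cesàro mean of a `[0,∞]`-valued function. -/
noncomputable def cesMean (g : ℝ → ℝ≥0∞) (x : ℝ) : ℝ≥0∞ :=
  (∫⁻ t in Ioc 0 x, g t) / ENNReal.ofReal x

lemma cesaroAbs_eq_cesMean (f : ℝ → ℝ) : cesaroAbs f = cesMean (fun t => ‖f t‖ₑ) := rfl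

lemma measurable_cesMean (g : ℝ → ℝ≥0∞) : Measurable (cesMean g) := by
  refine Measurable.div (Monotone.measurable fun x y hxy => ?_) ENNReal.measurable_ofReal
  exact lintegral_mono_set (Ioc_subset_Ioc_right hxy)

/-- The two kinds of interval on which the Cesàro-Orlicz spaces are considered. -/
def IsUnitOrHalfLine (I : Set ℝ) : Prop := I = Icc 0 1 ∨ I = Ici 0

lemma IsUnitOrHalfLine.measurableSet (hI : IsUnitOrHalfLine I) : MeasurableSet I := by
  rcases hI with rfl | rfl
  · exact measurableSet_Icc
  · exact measurableSet_Ici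

lemma IsUnitOrHalfLine.Ioc_subset (hI : IsUnitOrHalfLine I) {x : ℝ} (hx : x ∈ I) :
    Ioc 0 x ⊆ I := by
  rcases hI with rfl | rfl
  · exact fun t ht => ⟨ht.1.le, ht.2.trans hx.2⟩
  · exact fun t ht => ht.1.le

lemma IsUnitOrHalfLine.one_mem (hI : IsUnitOrHalfLine I) : (1 : ℝ) ∈ I := by
  rcases hI with rfl | rfl <;> simp

lemma IsUnitOrHalfLine.nonneg (hI : IsUnitOrHalfLine I) {x : ℝ} (hx : x ∈ I) : 0 ≤ x := by
  rcases hI with rfl | rfl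
  · exact hx.1
  · exact hx

/-- Properties of the means known only for a.e. `x` can be used at some `x ≥ y n`. On `[0,1]` the `y
n` must therefore stay below the endpoint. -/
lemma IsUnitOrHalfLine.exists_seq (hI : IsUnitOrHalfLine I) :
    ∃ y : ℕ → ℝ, (∀ n, volume (I ∩ Ici (y n)) ≠ 0) ∧
      ∀ᵐ t ∂(volume.restrict I), ∃ n, t ∈ Ioc 0 (y n) := by
  have h0 : ∀ᵐ t : ℝ, t ≠ 0 := by simp [ae_iff]
  have h1 : ∀ᵐ t : ℝ, t ≠ 1 := by simp [ae_iff]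
  rcases hI with rfl | rfl
  · refine ⟨fun n => 1 - 1 / (n + 1), fun n => ?_, ?_⟩
    · have hn : (0 : ℝ) < 1 / ((n : ℝ) + 1) := by positivity
      have : Icc (1 - 1 / ((n : ℝ) + 1)) 1 ⊆ Icc 0 1 ∩ Ici (1 - 1 / ((n : ℝ) + 1)) := by
        intro x hx
        have : 1 / ((n : ℝ) + 1) ≤ 1 := by
          rw [div_le_one (by positivity)]
          linarith [n.cast_nonneg (α := ℝ)]
        exact ⟨⟨by linarith [hx.1], hx.2⟩, hx.1⟩
      refine fun h => absurd (measure_mono_null this h) ?_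
      simp only [Real.volume_Icc, sub_sub_cancel, ENNReal.ofReal_eq_zero, not_le]
      exact hn
    · rw [ae_restrict_iff' measurableSet_Icc]
      filter_upwards [h0, h1] with t ht0 ht1 ht
      obtain ⟨n, hn⟩ := exists_nat_one_div_lt (sub_pos.2 (lt_of_le_of_ne ht.2 ht1))
      exact ⟨n, lt_of_le_of_ne ht.1 ht0.symm, by linarith⟩
  · refine ⟨fun n => n, fun n => ?_, ?_⟩
    · have : Ici (0 : ℝ) ∩ Ici (n : ℝ) = Ici (n : ℝ) :=
        inter_eq_right.2 (Ici_subset_Ici.2 n.cast_nonneg)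
      rw [this]
      simp
    · rw [ae_restrict_iff' measurableSet_Ici]
      filter_upwards [h0] with t ht0 ht
      obtain ⟨n, hn⟩ := exists_nat_ge t
      exact ⟨n, lt_of_le_of_ne ht ht0.symm, hn⟩

lemma cesMean_mono_ae (hI : IsUnitOrHalfLine I) {g h : ℝ → ℝ≥0∞}
    (hgh : ∀ᵐ t ∂(volume.restrict I), g t ≤ h t) {x : ℝ} (hx : x ∈ I) :
    cesMean g x ≤ cesMean h x := by
  refine ENNReal.div_le_div_right (lintegral_mono_ae ?_) _
  exact ae_restrict_of_ae_restrict_of_subset (hI.Ioc_subset hx) hgh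

lemma cesMean_congr_ae (hI : IsUnitOrHalfLine I) {g h : ℝ → ℝ≥0∞}
    (hgh : ∀ᵐ t ∂(volume.restrict I), g t = h t) {x : ℝ} (hx : x ∈ I) :
    cesMean g x = cesMean h x :=
  le_antisymm (cesMean_mono_ae hI (hgh.mono fun _ h => h.le) hx)
    (cesMean_mono_ae hI (hgh.mono fun _ h => h.ge) hx)

lemma cesMean_const_mul {c : ℝ≥0∞} (hc : c ≠ ∞) (g : ℝ → ℝ≥0∞) (x : ℝ) :
    cesMean (fun t => c * g t) x = c * cesMean g x := by
  rw [cesMean, lintegral_const_mul' _ _ hc, mul_div_assoc, cesMean]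

lemma cesMean_iSup (hI : IsUnitOrHalfLine I) {g : ℕ → ℝ → ℝ≥0∞}
    (hg : ∀ n, AEMeasurable (g n) (volume.restrict I))
    (hmono : ∀ t, Monotone fun n => g n t) {x : ℝ} (hx : x ∈ I) :
    cesMean (fun t => ⨆ n, g n t) x = ⨆ n, cesMean (g n) x := by
  unfold cesMean
  rw [lintegral_iSup' (fun n => (hg n).mono_measure
    (Measure.restrict_mono_set _ (hI.Ioc_subset hx))) (Eventually.of_forall hmono),
    ENNReal.iSup_div]

/-- The Fatou property of the modular of `Ces_φ`. -/
lemma IsOrlicz.modular_cesMean_iSup_le (hφ : IsOrlicz φ) (hI : IsUnitOrHalfLine I)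
    {g : ℕ → ℝ → ℝ≥0∞} (hg : ∀ n, AEMeasurable (g n) (volume.restrict I))
    (hmono : ∀ t, Monotone fun n => g n t) (l : ℝ) :
    modular φ I (fun x => cesMean (fun t => ⨆ n, g n t) x / ENNReal.ofReal l) ≤
      ⨆ n, modular φ I (fun x => cesMean (g n) x / ENNReal.ofReal l) := by
  unfold modular
  rw [← lintegral_iSup]
  · refine setLIntegral_mono' hI.measurableSet fun x hx => ?_
    dsimp only
    rw [cesMean_iSup hI hg hmono hx, ENNReal.iSup_div]
    exact hφ.ext_iSup_le _
  · exact fun n => hφ.measurable_ext.comp ((measurable_cesMean _).div_const _)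
  · refine fun m n hmn x => hφ.ext_mono (ENNReal.div_le_div_right ?_ _)
    exact ENNReal.div_le_div_right (lintegral_mono fun t => hmono t hmn) _

lemma IsOrlicz.ae_cesMean_lt_top (hφ : IsOrlicz φ) {g : ℝ → ℝ≥0∞} {l : ℝ}
    (h : modular φ I (fun x => cesMean g x / ENNReal.ofReal l) < ∞) :
    ∀ᵐ x ∂(volume.restrict I), cesMean g x < ∞ := by
  have h1 := ae_lt_top (hφ.measurable_ext.comp ((measurable_cesMean g).div_const
    (ENNReal.ofReal l))) h.ne
  filter_upwards [h1] with x hx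
  by_contra hx'
  rw [not_lt_top_iff] at hx'
  simp [hx', ENNReal.top_div, ext_top] at hx

/-- One finite mean at `x` makes `g` integrable on `(0, x]`; such intervals exhaust `I` up to a null
set. -/
lemma ae_lt_top_of_cesMean (hI : IsUnitOrHalfLine I) {g : ℝ → ℝ≥0∞}
    (hg : AEMeasurable g (volume.restrict I))
    (h : ∀ᵐ x ∂(volume.restrict I), cesMean g x < ∞) :
    ∀ᵐ t ∂(volume.restrict I), g t < ∞ := by
  obtain ⟨y, hy, hcover⟩ := hI.exists_seq
  have key : ∀ n, ∀ᵐ t ∂(volume.restrict I), t ∈ Ioc 0 (y n) → g t < ∞ := by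
    intro n
    rw [ae_restrict_iff' hI.measurableSet] at h
    obtain ⟨x, hx, hxy⟩ : ∃ x ∈ I ∩ Ici (y n), cesMean g x < ∞ := by
      by_contra! hcon
      refine hy n (measure_mono_null (fun x hx => ?_) h)
      simpa using ⟨hx.1, (hcon x hx).antisymm' le_top⟩
    have hfin : ∫⁻ t in Ioc 0 x, g t ≠ ∞ := by
      intro htop
      rw [cesMean, htop, ENNReal.top_div_of_ne_top ENNReal.ofReal_ne_top] at hxy
      exact lt_irrefl _ hxy
    have h2 : ∀ᵐ t ∂(volume.restrict (Ioc 0 x)), g t < ∞ :=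
      ae_lt_top' (hg.mono_measure (Measure.restrict_mono_set _ (hI.Ioc_subset hx.1))) hfin
    rw [ae_restrict_iff' measurableSet_Ioc] at h2
    filter_upwards [ae_restrict_of_ae h2] with t ht ht'
    exact ht ⟨ht'.1, ht'.2.trans hx.2⟩
  filter_upwards [ae_all_iff.2 key, hcover] with t ht ⟨n, hn⟩
  exact ht n hn

end CesMean

/-! ### `Δ₂` implies order continuity -/

section OrderContinuity

/-- A common form of the two `Δ₂` conditions, relative to the measure of the interval. -/
def Delta2On (φ : ℝ≥0 → ℝ≥0∞) (I : Set ℝ) : Prop :=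
  ∃ D K : ℝ≥0, (D = 0 ∨ volume I < ∞) ∧ ∀ v, ext φ (2 * v) ≤ D + K * ext φ v

/-- Below `u₀` monotonicity bounds `φ (2 * v)` by the constant `φ (2 * u₀)`, which is integrable
over an interval of finite length. -/
lemma Delta2Infty.delta2On (h : Delta2Infty φ) (hφ : IsOrlicz φ) :
    Delta2On φ (Icc 0 1) := by
  obtain ⟨K, u₀, hK, -, hfin, h⟩ := h
  have hfin2 : φ (2 * u₀) < ∞ :=
    (h u₀ le_rfl).trans_lt (ENNReal.mul_lt_top ENNReal.coe_lt_top hfin)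
  refine ⟨(φ (2 * u₀)).toNNReal, K, Or.inr (by simp), fun v => ?_⟩
  rw [ENNReal.coe_toNNReal hfin2.ne]
  induction v with
  | top => simp [ext_top, hK.ne']
  | coe v =>
    rw [show (2 : ℝ≥0∞) * v = ((2 * v : ℝ≥0) : ℝ≥0∞) by push_cast; rfl, ext_coe, ext_coe]
    rcases le_total u₀ v with hv | hv
    · exact (h v hv).trans le_add_self
    · exact (hφ.mono (by gcongr)).trans le_self_add

lemma Delta2All.delta2On (h : Delta2All φ) : Delta2On φ I := by
  obtain ⟨K, hK, h⟩ := h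
  refine ⟨0, K, Or.inl rfl, fun v => ?_⟩
  induction v with
  | top => simp [ext_top, hK.ne']
  | coe v =>
    rw [show (2 : ℝ≥0∞) * v = ((2 * v : ℝ≥0) : ℝ≥0∞) by push_cast; rfl, ext_coe, ext_coe]
    simpa using h v

lemma Delta2On.modular_two_mul_lt_top (h : Delta2On φ I) {g : ℝ → ℝ≥0∞}
    (hfin : modular φ I g < ∞) : modular φ I (fun t => 2 * g t) < ∞ := by
  obtain ⟨D, K, hD, h⟩ := h
  calc modular φ I (fun t => 2 * g t)
      ≤ ∫⁻ t in I, (D + K * ext φ (g t)) := lintegral_mono fun t => h _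
    _ = D * volume I + K * modular φ I g := by
        rw [lintegral_add_left measurable_const,
          lintegral_const_mul' _ _ ENNReal.coe_ne_top, modular]
        simp
    _ < ∞ := by
        refine ENNReal.add_lt_top.2 ⟨?_, ENNReal.mul_lt_top ENNReal.coe_lt_top hfin⟩
        rcases hD with rfl | hD
        · simp
        · exact ENNReal.mul_lt_top ENNReal.coe_lt_top hD

lemma Delta2On.modular_const_mul_lt_top (h : Delta2On φ I) (hφ : IsOrlicz φ)
    {g : ℝ → ℝ≥0∞} {l : ℝ} (hl : 0 < l)
    (hfin : modular φ I (fun t => g t / ENNReal.ofReal l) < ∞) {l' : ℝ} (hl' : 0 < l') :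
    modular φ I (fun t => g t / ENNReal.ofReal l') < ∞ := by
  have hpow : ∀ n : ℕ, modular φ I (fun t => 2 ^ n * (g t / ENNReal.ofReal l)) < ∞ := by
    intro n
    induction n with
    | zero => simpa using hfin
    | succ n ih =>
      have := h.modular_two_mul_lt_top ih
      simpa [pow_succ', mul_assoc] using this
  obtain ⟨n, hn⟩ := pow_unbounded_of_one_lt (l / l') one_lt_two
  refine lt_of_le_of_lt (lintegral_mono fun t => hφ.ext_mono ?_) (hpow n)
  have h1 : (ENNReal.ofReal l')⁻¹ ≤ 2 ^ n * (ENNReal.ofReal l)⁻¹ := by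
    rw [← ENNReal.ofReal_inv_of_pos hl, ← ENNReal.ofReal_inv_of_pos hl',
      show (2 : ℝ≥0∞) ^ n = ENNReal.ofReal (2 ^ n) by rw [ENNReal.ofReal_pow] <;> simp,
      ← ENNReal.ofReal_mul (by positivity)]
    apply ENNReal.ofReal_le_ofReal
    rw [div_lt_iff₀ hl'] at hn
    field_simp
    linarith
  calc g t / ENNReal.ofReal l' ≤ g t * (2 ^ n * (ENNReal.ofReal l)⁻¹) := by
        rw [div_eq_mul_inv]; gcongr
    _ = 2 ^ n * (g t / ENNReal.ofReal l) := by rw [div_eq_mul_inv]; ring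

lemma IsOrlicz.tendsto_modular_zero (hφ : IsOrlicz φ) {g : ℝ → ℝ≥0∞} {G : ℕ → ℝ → ℝ≥0∞}
    (hG : ∀ n, Measurable (G n)) (hle : ∀ n, ∀ᵐ t ∂(volume.restrict I), G n t ≤ g t)
    (hlim : ∀ᵐ t ∂(volume.restrict I), Tendsto (fun n => G n t) atTop (𝓝 0))
    (hfin : modular φ I g < ∞) :
    Tendsto (fun n => modular φ I (G n)) atTop (𝓝 0) := by
  have := tendsto_lintegral_of_dominated_convergence (μ := volume.restrict I)
    (F := fun n t => ext φ (G n t)) (f := fun _ => 0) (fun t => ext φ (g t))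
    (fun n => hφ.measurable_ext.comp (hG n))
    (fun n => (hle n).mono fun t ht => hφ.ext_mono ht) hfin.ne
    (hlim.mono fun t ht => hφ.tendsto_ext_zero.comp ht)
  simpa [modular] using this

lemma tendsto_cesMean_zero (hI : IsUnitOrHalfLine I) {g : ℝ → ℝ≥0∞} {G : ℕ → ℝ → ℝ≥0∞}
    (hG : ∀ n, AEMeasurable (G n) (volume.restrict I))
    (hle : ∀ n, ∀ᵐ t ∂(volume.restrict I), G n t ≤ g t)
    (hlim : ∀ᵐ t ∂(volume.restrict I), Tendsto (fun n => G n t) atTop (𝓝 0))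
    {x : ℝ} (hx : x ∈ I) (hfin : cesMean g x < ∞) :
    Tendsto (fun n => cesMean (G n) x) atTop (𝓝 0) := by
  -- At `x = 0` every mean is `0 / 0 = 0`.
  rcases (hI.nonneg hx).eq_or_lt with rfl | hx0
  · simp [cesMean]
  have hne : ENNReal.ofReal x ≠ 0 := by simpa using hx0
  have hfin' : ∫⁻ t in Ioc 0 x, g t ≠ ∞ := by
    intro htop
    rw [cesMean, htop, ENNReal.top_div_of_ne_top ENNReal.ofReal_ne_top] at hfin
    exact lt_irrefl _ hfin
  have hsub := hI.Ioc_subset hx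
  have := tendsto_lintegral_of_dominated_convergence' (μ := volume.restrict (Ioc 0 x))
    (F := G) (f := fun _ => 0) g
    (fun n => (hG n).mono_measure (Measure.restrict_mono_set _ hsub))
    (fun n => ae_restrict_of_ae_restrict_of_subset hsub (hle n)) hfin'
    (ae_restrict_of_ae_restrict_of_subset hsub hlim)
  simpa [cesMean] using ENNReal.Tendsto.div_const this (Or.inr hne)

lemma aemeasurable_enorm_L0 (f : L0 I) :
    AEMeasurable (fun t => ‖f t‖ₑ) (volume.restrict I) :=
  f.aestronglyMeasurable.enorm

lemma IsUnitOrHalfLine.isOrderContinuous (hI : IsUnitOrHalfLine I) (hφ : IsOrlicz φ)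
    (h : Delta2On φ I) : IsOrderContinuous (Ces φ I) (cesNorm φ I) := by
  rintro f ⟨l, hl, hfin⟩ g - hg hlim
  rw [cesaroAbs_eq_cesMean] at hfin
  have hle : ∀ n, ∀ᵐ t ∂(volume.restrict I), ‖g n t‖ₑ ≤ ‖f t‖ₑ := by
    intro n
    filter_upwards [AEEqFun.coeFn_le.2 (hg n).1, AEEqFun.coeFn_le.2 (hg n).2,
      AEEqFun.coeFn_abs f, AEEqFun.coeFn_zero (μ := volume.restrict I) (β := ℝ) (α := ℝ)]
      with t h0 h1 h2 h3
    rw [h2] at h1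
    rw [h3] at h0
    rw [enorm_le_iff_norm_le, Real.norm_eq_abs, Real.norm_eq_abs, abs_of_nonneg h0]
    exact h1
  have hlim' : ∀ᵐ t ∂(volume.restrict I), Tendsto (fun n => ‖g n t‖ₑ) atTop (𝓝 0) := by
    filter_upwards [hlim] with t ht
    simpa using ht.enorm
  have key : ∀ ε : ℝ, 0 < ε → ∀ᶠ n in atTop, cesNorm φ I (g n) ≤ ε := by
    intro ε hε
    have hfin' := h.modular_const_mul_lt_top hφ hl hfin hε
    have hε' : ENNReal.ofReal ε ≠ 0 := by simpa using hε
    have hlim2 : ∀ᵐ x ∂(volume.restrict I),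
        Tendsto (fun n => cesaroAbs (g n) x / ENNReal.ofReal ε) atTop (𝓝 0) := by
      filter_upwards [hφ.ae_cesMean_lt_top hfin, ae_restrict_mem hI.measurableSet]
        with x hx hxI
      have := tendsto_cesMean_zero hI (fun n => aemeasurable_enorm_L0 (g n)) hle hlim' hxI hx
      simpa [cesaroAbs_eq_cesMean] using ENNReal.Tendsto.div_const this (Or.inr hε')
    have := hφ.tendsto_modular_zero (I := I)
      (G := fun n x => cesaroAbs (g n) x / ENNReal.ofReal ε)
      (fun n => (measurable_cesMean _).div_const _)
      (fun n => (ae_restrict_mem hI.measurableSet).mono fun x hx =>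
        ENNReal.div_le_div_right (cesMean_mono_ae hI (hle n) hx) _) hlim2 hfin'
    filter_upwards [this.eventually (Iic_mem_nhds one_pos)] with n hn
    exact luxNorm_le hε hn
  rw [Metric.tendsto_atTop']
  intro ε hε
  obtain ⟨N, hN⟩ := eventually_atTop.1 (key (ε / 2) (by positivity))
  refine ⟨N, fun n hn => ?_⟩
  rw [Real.dist_0_eq_abs, cesNorm, abs_of_nonneg (luxNorm_nonneg _)]
  exact (hN n hn.le).trans_lt (by linarith)

end OrderContinuity

/-! ### Averages over signs and Khintchine's inequality -/

section SignMean

/-- The sign at `k` of the choice of signs that is `1` on `A` and `-1` elsewhere. -/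
noncomputable def sgn (A : Finset ℕ) (k : ℕ) : ℝ := if k ∈ A then 1 else -1

/-- The signed sum `∑_{k < n} ± a_k`. -/
noncomputable def signSum (a : ℕ → ℝ) (n : ℕ) (A : Finset ℕ) : ℝ := ∑ k ∈ Finset.range n, sgn A k * a k

/-- The mean over all choices of signs for the indices below `n`. -/
noncomputable def signMean (n : ℕ) (c : Finset ℕ → ℝ≥0∞) : ℝ≥0∞ :=
  (2 ^ n)⁻¹ * ∑ A ∈ (Finset.range n).powerset, c A

lemma sum_powerset_range_succ {M : Type*} [AddCommMonoid M] (n : ℕ) (c : Finset ℕ → M) :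
    ∑ A ∈ (Finset.range (n + 1)).powerset, c A =
      ∑ A ∈ (Finset.range n).powerset, (c A + c (insert n A)) := by
  rw [Finset.range_add_one, Finset.sum_powerset_insert Finset.notMem_range_self,
    Finset.sum_add_distrib]

lemma signSum_succ {a : ℕ → ℝ} {n : ℕ} {A : Finset ℕ} (hA : A ⊆ Finset.range n) :
    signSum a (n + 1) A = signSum a n A - a n := by
  have : n ∉ A := fun h => Finset.notMem_range_self (hA h)
  simp [signSum, Finset.sum_range_succ, sgn, this, sub_eq_add_neg]

lemma signSum_succ_insert (a : ℕ → ℝ) (n : ℕ) (A : Finset ℕ) :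
    signSum a (n + 1) (insert n A) = signSum a n A + a n := by
  simp only [signSum, Finset.sum_range_succ, sgn, Finset.mem_insert, true_or, if_true, one_mul]
  congr 1
  refine Finset.sum_congr rfl fun k hk => ?_
  simp [(Finset.mem_range.1 hk).ne]

lemma signMean_succ (n : ℕ) (c : Finset ℕ → ℝ≥0∞) :
    signMean (n + 1) c = signMean n fun A => (c A + c (insert n A)) / 2 := by
  rw [signMean, signMean, sum_powerset_range_succ]
  simp_rw [div_eq_mul_inv]
  rw [← Finset.sum_mul, pow_succ, ENNReal.mul_inv (by simp) (by simp)]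
  ring

lemma signMean_mono {n : ℕ} {c d : Finset ℕ → ℝ≥0∞}
    (h : ∀ A ⊆ Finset.range n, c A ≤ d A) : signMean n c ≤ signMean n d := by
  unfold signMean
  gcongr with A hA
  exact h A (Finset.mem_powerset.1 hA)

lemma signMean_const (n : ℕ) (r : ℝ≥0∞) : signMean n (fun _ => r) = r := by
  rw [signMean, Finset.sum_const, Finset.card_powerset, Finset.card_range, nsmul_eq_mul,
    ← mul_assoc]
  push_cast
  rw [ENNReal.inv_mul_cancel (by simp) (by simp), one_mul]

/-- Jensen's inequality, obtained by pairing the two signs of the last index and using midpoint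
convexity. -/
lemma IsOrlicz.ext_signMean_le (hφ : IsOrlicz φ) (n : ℕ) (c : Finset ℕ → ℝ≥0∞) :
    ext φ (signMean n c) ≤ signMean n fun A => ext φ (c A) := by
  induction n generalizing c with
  | zero => simp [signMean]
  | succ n ih =>
    rw [signMean_succ, signMean_succ]
    exact (ih _).trans (signMean_mono fun A _ => hφ.ext_add_div_two_le _ _)

lemma enorm_le_half_add (x y : ℝ) : ‖x‖ₑ ≤ (‖x - y‖ₑ + ‖x + y‖ₑ) / 2 := by
  rw [ENNReal.le_div_iff_mul_le (by simp) (by simp)]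
  calc ‖x‖ₑ * 2 = ‖(x - y) + (x + y)‖ₑ := by
        rw [show (x - y) + (x + y) = x * 2 by ring, enorm_mul]
        congr 1
        rw [Real.enorm_eq_ofReal (by norm_num)]
        simp
    _ ≤ _ := enorm_add_le _ _

lemma signMean_enorm_mono (a : ℕ → ℝ) :
    Monotone fun n => signMean n fun A => ‖signSum a n A‖ₑ := by
  refine monotone_nat_of_le_succ fun n => ?_
  rw [signMean_succ]
  refine signMean_mono fun A hA => ?_
  rw [signSum_succ hA, signSum_succ_insert]
  exact enorm_le_half_add _ _

/-- For fixed earlier signs, `a n` is half the difference of the two possible sums. -/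
lemma enorm_le_signMean (a : ℕ → ℝ) (n : ℕ) :
    ‖a n‖ₑ ≤ signMean (n + 1) fun A => ‖signSum a (n + 1) A‖ₑ := by
  rw [signMean_succ, ← signMean_const n ‖a n‖ₑ]
  refine signMean_mono fun A hA => ?_
  rw [signSum_succ hA, signSum_succ_insert, ← enorm_neg (signSum a n A - a n), neg_sub,
    add_comm (signSum a n A)]
  exact enorm_le_half_add _ _

lemma sum_signSum_sq (a : ℕ → ℝ) (n : ℕ) :
    ∑ A ∈ (Finset.range n).powerset, signSum a n A ^ 2 =
      2 ^ n * ∑ k ∈ Finset.range n, a k ^ 2 := by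
  induction n with
  | zero => simp [signSum]
  | succ n ih =>
    rw [sum_powerset_range_succ, Finset.sum_range_succ]
    calc ∑ A ∈ (Finset.range n).powerset,
          (signSum a (n + 1) A ^ 2 + signSum a (n + 1) (insert n A) ^ 2)
        = ∑ A ∈ (Finset.range n).powerset, (2 * signSum a n A ^ 2 + 2 * a n ^ 2) := by
          refine Finset.sum_congr rfl fun A hA => ?_
          rw [signSum_succ (Finset.mem_powerset.1 hA), signSum_succ_insert]
          ring
      _ = _ := by
          rw [Finset.sum_add_distrib, ← Finset.mul_sum, ih, Finset.sum_const,
            Finset.card_powerset, Finset.card_range, nsmul_eq_mul]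
          push_cast
          ring

lemma sum_signSum_pow_four_le (a : ℕ → ℝ) (n : ℕ) :
    ∑ A ∈ (Finset.range n).powerset, signSum a n A ^ 4 ≤
      2 ^ n * (3 * (∑ k ∈ Finset.range n, a k ^ 2) ^ 2) := by
  induction n with
  | zero => simp [signSum]
  | succ n ih =>
    rw [sum_powerset_range_succ, Finset.sum_range_succ]
    set Q := ∑ k ∈ Finset.range n, a k ^ 2
    calc ∑ A ∈ (Finset.range n).powerset,
          (signSum a (n + 1) A ^ 4 + signSum a (n + 1) (insert n A) ^ 4)
        = ∑ A ∈ (Finset.range n).powerset,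
            (2 * signSum a n A ^ 4 + 12 * a n ^ 2 * signSum a n A ^ 2 + 2 * a n ^ 4) := by
          refine Finset.sum_congr rfl fun A hA => ?_
          rw [signSum_succ (Finset.mem_powerset.1 hA), signSum_succ_insert]
          ring
      _ = 2 * ∑ A ∈ (Finset.range n).powerset, signSum a n A ^ 4
            + 12 * a n ^ 2 * (2 ^ n * Q) + 2 ^ n * (2 * a n ^ 4) := by
          rw [Finset.sum_add_distrib, Finset.sum_add_distrib, ← Finset.mul_sum,
            ← Finset.mul_sum, sum_signSum_sq, Finset.sum_const,
            Finset.card_powerset, Finset.card_range, nsmul_eq_mul]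
          push_cast
          ring
      -- The extra `4 * a n ^ 4` completes the square `3 * (Q + a n ^ 2) ^ 2`.
      _ ≤ 2 * (2 ^ n * (3 * Q ^ 2)) + 12 * a n ^ 2 * (2 ^ n * Q) + 2 ^ n * (2 * a n ^ 4)
            + 2 ^ n * (4 * a n ^ 4) := by
          have : (0 : ℝ) ≤ 2 ^ n * (4 * a n ^ 4) := by positivity
          linarith
      _ = _ := by ring

/-- Summed over signs, this bounds the first moment below by the second and fourth. It holds because
`w³ - 6q²w + 6q³` is positive at its minimum `w = √2 q` over `w ≥ 0` when `q > 0`. -/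
lemma six_mul_sq_mul_sq_sub_le {q : ℝ} (hq : 0 ≤ q) (t : ℝ) :
    6 * q ^ 2 * t ^ 2 - t ^ 4 ≤ 6 * q ^ 3 * |t| := by
  have hw := abs_nonneg t
  rw [← sq_abs t, show t ^ 4 = |t| ^ 4 by rw [← abs_pow, abs_of_nonneg (by positivity)]]
  set w := |t|
  -- `1.42` approximates `√2`; the two remainder terms restore the cubic exactly.
  have h : 0 ≤ w * ((w - 1.42 * q) ^ 2 * (w + 2.84 * q) + 0.0492 * q ^ 2 * w
      + 0.273424 * q ^ 3) := by positivity
  nlinarith [h]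

/-- A form of Khintchine's inequality. -/
lemma sum_sq_le_of_sum_abs_signSum_le {a : ℕ → ℝ} {n : ℕ} {M : ℝ}
    (h : ∑ A ∈ (Finset.range n).powerset, |signSum a n A| ≤ 2 ^ n * M) :
    ∑ k ∈ Finset.range n, a k ^ 2 ≤ 4 * M ^ 2 := by
  set Q := ∑ k ∈ Finset.range n, a k ^ 2 with hQ
  have hQ0 : 0 ≤ Q := Finset.sum_nonneg fun _ _ => sq_nonneg _
  rcases hQ0.eq_or_lt with h0 | hpos
  · rw [← h0]; positivity
  obtain ⟨q, hq, hqQ⟩ : ∃ q : ℝ, 0 < q ∧ Q = q ^ 2 :=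
    ⟨√Q, Real.sqrt_pos.2 hpos, (Real.sq_sqrt hQ0).symm⟩
  -- With `Q = q²` the left side is `2 ^ n * 3q⁴`, so `q ≤ 2M`: the source of the constant `4`.
  have h1 : 6 * q ^ 2 * (2 ^ n * Q) - 2 ^ n * (3 * Q ^ 2) ≤ 6 * q ^ 3 * (2 ^ n * M) := by
    calc 6 * q ^ 2 * (2 ^ n * Q) - 2 ^ n * (3 * Q ^ 2)
        ≤ 6 * q ^ 2 * ∑ A ∈ (Finset.range n).powerset, signSum a n A ^ 2
            - ∑ A ∈ (Finset.range n).powerset, signSum a n A ^ 4 := by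
          rw [sum_signSum_sq]
          linarith [sum_signSum_pow_four_le a n]
      _ = ∑ A ∈ (Finset.range n).powerset,
            (6 * q ^ 2 * signSum a n A ^ 2 - signSum a n A ^ 4) := by
          rw [Finset.sum_sub_distrib, Finset.mul_sum]
      _ ≤ ∑ A ∈ (Finset.range n).powerset, 6 * q ^ 3 * |signSum a n A| :=
          Finset.sum_le_sum fun A _ => six_mul_sq_mul_sq_sub_le hq.le _
      _ ≤ _ := by
          rw [← Finset.mul_sum]
          gcongr
  have h2 : (3 * q ^ 3 * 2 ^ n) * q ≤ (3 * q ^ 3 * 2 ^ n) * (2 * M) := by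
    rw [hqQ] at h1
    linarith
  have h3 : q ≤ 2 * M := le_of_mul_le_mul_left h2 (by positivity)
  rw [hqQ]
  nlinarith

lemma tendsto_zero_of_iSup_signMean_lt_top {a : ℕ → ℝ}
    (h : ⨆ n, signMean n (fun A => ‖signSum a n A‖ₑ) < ∞) : Tendsto a atTop (𝓝 0) := by
  obtain ⟨M, hM⟩ : ∃ M : ℝ≥0, (M : ℝ≥0∞) = _ := ⟨_, ENNReal.coe_toNNReal h.ne⟩
  have h1 : ∀ n, ∑ k ∈ Finset.range n, a k ^ 2 ≤ 4 * (M : ℝ) ^ 2 := by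
    intro n
    refine sum_sq_le_of_sum_abs_signSum_le ?_
    have h2 : signMean n (fun A => ‖signSum a n A‖ₑ) ≤ M := by
      rw [hM]
      exact le_iSup (fun n => signMean n (fun A => ‖signSum a n A‖ₑ)) n
    rw [signMean, ENNReal.inv_mul_le_iff (by simp) (by simp)] at h2
    have h3 : ∑ A ∈ (Finset.range n).powerset, ‖signSum a n A‖₊ ≤ 2 ^ n * M := by
      simp only [enorm_eq_nnnorm] at h2
      exact_mod_cast h2
    have h4 := NNReal.coe_le_coe.2 h3
    push_cast at h4
    simpa [Real.norm_eq_abs] using h4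
  have h2 : Summable fun k => a k ^ 2 :=
    summable_of_sum_range_le (fun _ => sq_nonneg _) h1
  have h3 := h2.tendsto_atTop_zero.sqrt
  simp only [Real.sqrt_sq_eq_abs, Real.sqrt_zero] at h3
  exact (tendsto_zero_iff_abs_tendsto_zero _).2 h3

end SignMean

/-! ### Order continuity excludes copies of `ℓ^∞` -/

section OrderContinuousNoLinfty

/-- The choice of signs `A`, restricted to the indices below `n`, as an element of `ℓ^∞`. -/
noncomputable def signVec (n : ℕ) (A : Finset ℕ) : lp (fun _ : ℕ => ℝ) ∞ :=
  ∑ k ∈ Finset.range n, sgn A k • lp.single ∞ k (1 : ℝ)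

lemma norm_signVec_le (n : ℕ) (A : Finset ℕ) : ‖signVec n A‖ ≤ 1 := by
  refine lp.norm_le_of_forall_le zero_le_one fun i => ?_
  have : (signVec n A : ℕ → ℝ) i = if i ∈ Finset.range n then sgn A i else 0 := by
    rw [signVec, lp.coeFn_sum, Finset.sum_apply]
    simp [lp.single_apply, Pi.single_apply]
  rw [this]
  split_ifs
  · unfold sgn; split_ifs <;> simp
  · simp

lemma coeFn_map_signVec (T : lp (fun _ : ℕ => ℝ) ∞ →ₗ[ℝ] L0 I) (n : ℕ) (A : Finset ℕ) :
    ∀ᵐ t ∂(volume.restrict I),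
      T (signVec n A) t = signSum (fun k => T (lp.single ∞ k (1 : ℝ)) t) n A := by
  rw [signVec, map_sum]
  induction n with
  | zero =>
    filter_upwards [AEEqFun.coeFn_zero (μ := volume.restrict I) (β := ℝ) (α := ℝ)] with t ht
    simpa [signSum] using ht
  | succ n ih =>
    rw [Finset.sum_range_succ, map_smul]
    filter_upwards [ih, AEEqFun.coeFn_add (∑ k ∈ Finset.range n,
      T (sgn A k • lp.single ∞ k (1 : ℝ))) (sgn A n • T (lp.single ∞ n (1 : ℝ))),
      AEEqFun.coeFn_smul (sgn A n) (T (lp.single ∞ n (1 : ℝ)))] with t h1 h2 h3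
    rw [h2, Pi.add_apply, h1, h3, Pi.smul_apply, smul_eq_mul]
    simp [signSum, Finset.sum_range_succ]

lemma cesMean_signMean {n : ℕ} {c : Finset ℕ → ℝ → ℝ≥0∞} (hc : ∀ A, Measurable (c A))
    (x : ℝ) : cesMean (fun t => signMean n fun A => c A t) x =
      signMean n fun A => cesMean (c A) x := by
  unfold cesMean signMean
  rw [lintegral_const_mul' _ _ (by simp), lintegral_finsetSum _ fun A _ => hc A, mul_div_assoc]
  simp_rw [div_eq_mul_inv]
  rw [Finset.sum_mul]

lemma IsOrlicz.modular_cesMean_signMean_le (hφ : IsOrlicz φ) {n : ℕ}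
    {c : Finset ℕ → ℝ → ℝ≥0∞} (hc : ∀ A, Measurable (c A)) {l : ℝ}
    (h : ∀ A, modular φ I (fun x => cesMean (c A) x / ENNReal.ofReal l) ≤ 1) :
    modular φ I (fun x => cesMean (fun t => signMean n fun A => c A t) x
      / ENNReal.ofReal l) ≤ 1 := by
  calc modular φ I (fun x => cesMean (fun t => signMean n fun A => c A t) x
        / ENNReal.ofReal l)
      ≤ ∫⁻ x in I, signMean n fun A => ext φ (cesMean (c A) x / ENNReal.ofReal l) := by
        refine lintegral_mono fun x => ?_
        have e : cesMean (fun t => signMean n fun A => c A t) x / ENNReal.ofReal l =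
            signMean n fun A => cesMean (c A) x / ENNReal.ofReal l := by
          rw [cesMean_signMean hc]
          unfold signMean
          rw [mul_div_assoc]
          simp_rw [div_eq_mul_inv]
          rw [Finset.sum_mul]
        dsimp only
        rw [e]
        exact hφ.ext_signMean_le _ _
    _ = signMean n fun A => modular φ I (fun x => cesMean (c A) x / ENNReal.ofReal l) := by
        unfold signMean modular
        rw [lintegral_const_mul' _ _ (by simp), lintegral_finsetSum]
        exact fun A _ => hφ.measurable_ext.comp ((measurable_cesMean _).div_const _)
    _ ≤ signMean n fun _ => 1 := signMean_mono fun A _ => h A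
    _ = 1 := signMean_const _ _

lemma measurable_signMean_signSum {F : ℕ → ℝ → ℝ} (hF : ∀ k, Measurable (F k)) (n : ℕ) :
    (∀ A, Measurable fun t => ‖signSum (fun k => F k t) n A‖ₑ) ∧
      Measurable fun t => signMean n fun A => ‖signSum (fun k => F k t) n A‖ₑ := by
  have h : ∀ A, Measurable fun t => ‖signSum (fun k => F k t) n A‖ₑ := fun A =>
    (Finset.measurable_sum _ fun k _ => (hF k).const_mul _).enorm
  exact ⟨h, (Finset.measurable_sum _ fun A _ => h A).const_mul _⟩

lemma enorm_coeFn_abs (f : L0 I) :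
    ∀ᵐ t ∂(volume.restrict I), ‖(|f| : L0 I) t‖ₑ = ‖f t‖ₑ := by
  filter_upwards [AEEqFun.coeFn_abs f] with t ht
  rw [ht, ← ofReal_norm, ← ofReal_norm, norm_abs_eq_norm]

/-- Since `Ces_φ` has the Fatou property, it contains no copy of `ℓ^∞` if it is order
continuous. -/
lemma IsUnitOrHalfLine.not_containsLinfty (hI : IsUnitOrHalfLine I) (hφ : IsOrlicz φ)
    (h : IsOrderContinuous (Ces φ I) (cesNorm φ I)) :
    ¬ ContainsLinfty (Ces φ I) (cesNorm φ I) := by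
  rintro ⟨T, hT, a, b, ha, hb, hab⟩
  set e : ℕ → lp (fun _ : ℕ => ℝ) ∞ := fun k => lp.single ∞ k (1 : ℝ) with he
  have hnorm_e : ∀ k, ‖e k‖ = 1 := fun k => by simp [he]
  set F : ℕ → ℝ → ℝ := fun k t => T (e k) t with hF
  have hFm : ∀ k, Measurable (F k) := fun k => (T (e k)).stronglyMeasurable.measurable
  set S : ℕ → ℝ → ℝ≥0∞ := fun n t => signMean n fun A => ‖signSum (fun k => F k t) n A‖ₑ
    with hS
  set G : ℝ → ℝ≥0∞ := fun t => ⨆ n, S n t with hG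
  have hSm : ∀ n, Measurable (S n) := fun n => (measurable_signMean_signSum hFm n).2
  have hSmono : ∀ t, Monotone fun n => S n t := fun t => signMean_enorm_mono _
  have hGm : Measurable G := Measurable.iSup hSm
  -- Modular at most `1` is available only strictly above the norm, hence `b + 1` rather than `b`.
  have hmodS : ∀ n, modular φ I (fun x => cesMean (S n) x / ENNReal.ofReal (b + 1)) ≤ 1 := by
    intro n
    refine hφ.modular_cesMean_signMean_le (measurable_signMean_signSum hFm n).1 fun A => ?_
    have hlt : luxNorm φ I (cesaroAbs (T (signVec n A))) < b + 1 := by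
      have h1 := (hab (signVec n A)).2
      have h2 := norm_signVec_le n A
      have h3 : b * ‖signVec n A‖ ≤ b * 1 := by gcongr
      rw [cesNorm] at h1
      linarith
    refine le_trans (hφ.modular_mono hI.measurableSet fun x hx => ?_)
      (hφ.modular_le_one_of_luxNorm_lt (hT _) hlt)
    refine ENNReal.div_le_div_right (cesMean_mono_ae hI ?_ hx) _
    filter_upwards [coeFn_map_signVec T n A] with t ht
    rw [ht]
  have hmodG : modular φ I (fun x => cesMean G x / ENNReal.ofReal (b + 1)) ≤ 1 :=
    (hφ.modular_cesMean_iSup_le hI (fun n => (hSm n).aemeasurable) hSmono _).trans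
      (iSup_le hmodS)
  have hGfin : ∀ᵐ t ∂(volume.restrict I), G t < ∞ :=
    ae_lt_top_of_cesMean hI hGm.aemeasurable
      (hφ.ae_cesMean_lt_top (hmodG.trans_lt ENNReal.one_lt_top))
  have hle : ∀ n t, ‖F n t‖ₑ ≤ G t := fun n t =>
    (enorm_le_signMean (fun k => F k t) n).trans (le_iSup (fun n => S n t) (n + 1))
  set f : L0 I := AEEqFun.mk (fun t => (G t).toReal)
    hGm.ennreal_toReal.aestronglyMeasurable with hf
  have hfG : ∀ᵐ t ∂(volume.restrict I), f t = (G t).toReal := AEEqFun.coeFn_mk _ _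
  have hfC : f ∈ Ces φ I := by
    refine ⟨b + 1, by positivity, lt_of_le_of_lt ?_ (hmodG.trans_lt ENNReal.one_lt_top)⟩
    refine hφ.modular_mono hI.measurableSet fun x hx => ?_
    refine ENNReal.div_le_div_right (cesMean_mono_ae hI ?_ hx) _
    filter_upwards [hfG] with t ht
    rw [ht, Real.enorm_of_nonneg ENNReal.toReal_nonneg]
    exact ENNReal.ofReal_toReal_le
  have hCabs : ∀ n x, x ∈ I → cesaroAbs (|T (e n)| : L0 I) x = cesaroAbs (T (e n)) x :=
    fun n x hx => cesMean_congr_ae hI (enorm_coeFn_abs _) hx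
  have hmodabs : ∀ n l, modular φ I
      (fun x => cesaroAbs (|T (e n)| : L0 I) x / ENNReal.ofReal l) =
      modular φ I (fun x => cesaroAbs (T (e n)) x / ENNReal.ofReal l) := fun n l =>
    setLIntegral_congr_fun hI.measurableSet fun x hx => by simp only [hCabs n x hx]
  have hlim := h f hfC (fun n => |T (e n)|) (fun n => ?_) (fun n => ⟨?_, ?_⟩) ?_
  · have h1 : ∀ n, a ≤ cesNorm φ I (|T (e n)| : L0 I) := by
      intro n
      have := (hab (e n)).1
      rw [hnorm_e, mul_one] at this
      simpa only [cesNorm, luxNorm, hmodabs] using this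
    exact absurd (ge_of_tendsto' hlim h1) (not_le.2 ha)
  · simpa only [Ces, mem_ofPred_eq, hmodabs] using hT (e n)
  · rw [← AEEqFun.coeFn_le]
    filter_upwards [AEEqFun.coeFn_abs (T (e n)),
      AEEqFun.coeFn_zero (μ := volume.restrict I) (β := ℝ) (α := ℝ)] with t h1 h2
    rw [h1, h2]
    exact abs_nonneg _
  · rw [← AEEqFun.coeFn_le]
    filter_upwards [AEEqFun.coeFn_abs f, AEEqFun.coeFn_abs (T (e n)), hfG, hGfin]
      with t h1 h2 h3 h4
    rw [h1, h2, h3, abs_of_nonneg ENNReal.toReal_nonneg]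
    have := (ENNReal.toReal_le_toReal (by simp) h4.ne).2 (hle n t)
    simpa using this
  · have h1 : ∀ᵐ t ∂(volume.restrict I), ∀ n, (|T (e n)| : L0 I) t = |F n t| :=
      ae_all_iff.2 fun n => AEEqFun.coeFn_abs _
    filter_upwards [h1, hGfin] with t h1 h2
    simp only [h1]
    simpa using (tendsto_zero_of_iSup_signMean_lt_top h2).abs

end OrderContinuousNoLinfty

/-! ### Copies of `ℓ^∞` from tails that do not vanish -/

section LinftyCopy

/-- The multiplication of `H` by the value of a sequence at the index `κ t`. -/
noncomputable def stepMul (I : Set ℝ) (κ : ℝ → ℕ) (hκ : Measurable κ) (H : ℝ → ℝ) (hH : Measurable H) :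
    lp (fun _ : ℕ => ℝ) ∞ →ₗ[ℝ] L0 I where
  toFun x := AEEqFun.mk (fun t => x (κ t) * H t)
    (((measurable_from_nat (f := fun k => x k)).comp hκ).mul hH).aestronglyMeasurable
  map_add' x y := by
    rw [AEEqFun.mk_add_mk]
    refine AEEqFun.mk_eq_mk.2 (Eventually.of_forall fun t => ?_)
    simp [add_mul]
  map_smul' c x := by
    rw [RingHom.id_apply, AEEqFun.smul_mk]
    refine AEEqFun.mk_eq_mk.2 (Eventually.of_forall fun t => ?_)
    simp [mul_assoc]

lemma enorm_stepMul {κ : ℝ → ℕ} (hκ : Measurable κ) {H : ℝ → ℝ} (hH : Measurable H)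
    (x : lp (fun _ : ℕ => ℝ) ∞) :
    ∀ᵐ t ∂(volume.restrict I), ‖stepMul I κ hκ H hH x t‖ₑ = ‖x (κ t)‖ₑ * ‖H t‖ₑ := by
  have h : ∀ᵐ t ∂(volume.restrict I), stepMul I κ hκ H hH x t = x (κ t) * H t :=
    AEEqFun.coeFn_mk _ _
  filter_upwards [h] with t ht
  rw [ht, enorm_mul]

/-- As `m` grows, `A n \ A m` exhausts `A n`, so by Fatou some such block already has modular above
`1`; iterate from its end. -/
lemma exists_seq_disjoint_blocks (hφ : IsOrlicz φ) (hI : IsUnitOrHalfLine I)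
    {h : ℝ → ℝ≥0∞} (hh : Measurable h) {A : ℕ → Set ℝ} (hAm : ∀ n, MeasurableSet (A n))
    (hA : Antitone A) (hAe : ∀ t, ∃ n, t ∉ A n) {r : ℝ}
    (hbig : ∀ n, 1 < modular φ I (fun x => cesMean ((A n).indicator h) x / ENNReal.ofReal r)) :
    ∃ N : ℕ → ℕ, StrictMono N ∧ ∀ k, 1 < modular φ I (fun x =>
      cesMean ((A (N k) \ A (N (k + 1))).indicator h) x / ENNReal.ofReal r) := by
  have step : ∀ n, ∃ m, n < m ∧ 1 < modular φ I (fun x =>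
      cesMean ((A n \ A m).indicator h) x / ENNReal.ofReal r) := by
    intro n
    have hmono : ∀ t, Monotone fun m => (A n \ A m).indicator h t := fun t m m' hmm =>
      indicator_le_indicator_of_subset (sdiff_subset_sdiff_right (hA hmm)) (fun _ => zero_le) t
    have hsup : (A n).indicator h = fun t => ⨆ m, (A n \ A m).indicator h t := by
      funext t
      refine le_antisymm ?_ (iSup_le fun m =>
        indicator_le_indicator_of_subset sdiff_subset (fun _ => zero_le) t)
      obtain ⟨m, hm⟩ := hAe t
      refine le_trans (le_of_eq ?_) (le_iSup (fun m => (A n \ A m).indicator h t) m)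
      by_cases ht : t ∈ A n
      · rw [indicator_of_mem ht, indicator_of_mem (show t ∈ A n \ A m from ⟨ht, hm⟩)]
      · rw [indicator_of_notMem ht, indicator_of_notMem (fun h => ht h.1)]
    have h1 := hbig n
    rw [hsup] at h1
    obtain ⟨m, hm⟩ := lt_iSup_iff.1 (h1.trans_le (hφ.modular_cesMean_iSup_le hI
      (fun m => (hh.indicator ((hAm n).diff (hAm m))).aemeasurable) hmono r))
    refine ⟨max m (n + 1), by omega, hm.trans_le (hφ.modular_mono hI.measurableSet ?_)⟩
    intro x hx
    refine ENNReal.div_le_div_right (cesMean_mono_ae hI (Eventually.of_forall fun t => ?_) hx) _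
    exact hmono t (le_max_left _ _)
  choose g hg1 hg2 using step
  refine ⟨fun k => g^[k] 0, strictMono_nat_of_lt_succ fun k => ?_, fun k => ?_⟩
  · rw [Function.iterate_succ_apply']
    exact hg1 _
  · simp only [Function.iterate_succ_apply']
    exact hg2 _

/-- If the tails of an element of `Ces_φ` along a decreasing sequence of sets do not vanish in
norm, then `Ces_φ` contains a copy of `ℓ^∞`. -/
lemma containsLinfty_of_tails (hφ : IsOrlicz φ) (hI : IsUnitOrHalfLine I)
    {H : ℝ → ℝ} (hH : Measurable H)
    (hfin : ∃ l : ℝ, 0 < l ∧ modular φ I (fun x => cesaroAbs H x / ENNReal.ofReal l) < ∞)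
    {A : ℕ → Set ℝ} (hAm : ∀ n, MeasurableSet (A n))
    (hA : Antitone A) (hAe : ∀ t, ∃ n, t ∉ A n) {r : ℝ} (hr : 0 < r)
    (hbig : ∀ n, 1 < modular φ I (fun x =>
      cesMean ((A n).indicator fun t => ‖H t‖ₑ) x / ENNReal.ofReal r)) :
    ContainsLinfty (Ces φ I) (cesNorm φ I) := by
  classical
  obtain ⟨N, hN, hbig⟩ := exists_seq_disjoint_blocks hφ hI hH.enorm hAm hA hAe hbig
  have hex : ∀ t, ∃ k, t ∉ A (N (k + 1)) := fun t => by
    obtain ⟨n, hn⟩ := hAe t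
    exact ⟨n, fun h => hn (hA ((Nat.le_succ n).trans (hN.id_le _)) h)⟩
  -- The block index. Points outside `A (N 0)` also get index `0`, which is harmless: the lower
  -- bound uses only the blocks.
  set κ : ℝ → ℕ := fun t => Nat.find (hex t) with hκ_def
  have hκ : Measurable κ := measurable_find hex fun k => (hAm (N (k + 1))).compl
  have hκ_eq : ∀ k, ∀ t ∈ A (N k) \ A (N (k + 1)), κ t = k := by
    intro k t ht
    refine (Nat.find_eq_iff _).2 ⟨ht.2, fun j hj => not_not.2 ?_⟩
    exact hA (hN.monotone hj) ht.1
  set T := stepMul I κ hκ H hH with hT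
  obtain ⟨l, hl, hmod⟩ := hφ.exists_modular_le_one hfin
  -- The `ε` keeps the divisor positive when `x = 0`.
  have upper : ∀ (x : lp (fun _ : ℕ => ℝ) ∞) (ε : ℝ), 0 < ε → modular φ I
      (fun y => cesaroAbs (T x) y / ENNReal.ofReal ((‖x‖ + ε) * l)) ≤ 1 := by
    intro x ε hε
    have hpos : 0 < ‖x‖ + ε := by positivity
    refine (hφ.modular_mono hI.measurableSet fun y hy => ?_).trans hmod
    rw [ENNReal.ofReal_mul hpos.le]
    calc cesaroAbs (T x) y / (ENNReal.ofReal (‖x‖ + ε) * ENNReal.ofReal l)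
        ≤ cesMean (fun t => ENNReal.ofReal (‖x‖ + ε) * ‖H t‖ₑ) y /
            (ENNReal.ofReal (‖x‖ + ε) * ENNReal.ofReal l) := by
          refine ENNReal.div_le_div_right (cesMean_mono_ae hI ?_ hy) _
          filter_upwards [enorm_stepMul hκ hH x] with t ht
          rw [ht, ← ofReal_norm]
          gcongr
          exact (lp.norm_apply_le_norm ENNReal.top_ne_zero x _).trans (by linarith)
      _ = cesaroAbs H y / ENNReal.ofReal l := by
          rw [cesMean_const_mul ENNReal.ofReal_ne_top,
            ENNReal.mul_div_mul_left _ _ (by simpa using hpos) ENNReal.ofReal_ne_top]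
          rfl
  have hmem : ∀ x, T x ∈ Ces φ I := fun x =>
    ⟨(‖x‖ + 1) * l, by positivity, (upper x 1 one_pos).trans_lt ENNReal.one_lt_top⟩
  refine ⟨T, hmem, r, l, hr, hl, fun x => ⟨?_, ?_⟩⟩
  · have hk : ∀ k, r * ‖x k‖ ≤ cesNorm φ I (T x) := by
      intro k
      refine hφ.le_luxNorm (hmem x) fun m hm hm1 => ?_
      by_contra! hlt
      have hx : 0 < ‖x k‖ := by
        by_contra! h0
        nlinarith
      refine absurd (hbig k) (not_lt.2 (le_trans (hφ.modular_mono hI.measurableSet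
        fun y hy => ?_) hm1))
      have hx' : ENNReal.ofReal ‖x k‖ ≠ 0 := by simpa using hx
      calc cesMean ((A (N k) \ A (N (k + 1))).indicator fun t => ‖H t‖ₑ) y / ENNReal.ofReal r
          = cesMean (fun t => ENNReal.ofReal ‖x k‖ *
              (A (N k) \ A (N (k + 1))).indicator (fun t => ‖H t‖ₑ) t) y /
              ENNReal.ofReal (‖x k‖ * r) := by
            rw [cesMean_const_mul ENNReal.ofReal_ne_top, ENNReal.ofReal_mul hx.le,
              ENNReal.mul_div_mul_left _ _ hx' ENNReal.ofReal_ne_top]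
        _ ≤ cesaroAbs (T x) y / ENNReal.ofReal (‖x k‖ * r) := by
            refine ENNReal.div_le_div_right (cesMean_mono_ae hI ?_ hy) _
            filter_upwards [enorm_stepMul hκ hH x] with t ht
            rw [ht]
            by_cases hmemt : t ∈ A (N k) \ A (N (k + 1))
            · rw [indicator_of_mem hmemt, hκ_eq k t hmemt, ofReal_norm]
            · rw [indicator_of_notMem hmemt, mul_zero]
              exact zero_le
        _ ≤ cesaroAbs (T x) y / ENNReal.ofReal m := by
            gcongr
            linarith
    rw [← le_div_iff₀' hr]
    refine lp.norm_le_of_forall_le (div_nonneg (luxNorm_nonneg _) hr.le) fun k => ?_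
    rw [le_div_iff₀' hr]
    exact hk k
  · refine le_of_forall_pos_le_add fun ε hε => ?_
    have h1 : cesNorm φ I (T x) ≤ (‖x‖ + ε / l) * l :=
      luxNorm_le (by positivity) (upper x (ε / l) (by positivity))
    refine h1.trans (le_of_eq ?_)
    field_simp

end LinftyCopy

/-! ### Staircase functions with large tails -/

section Construction

lemma cesaroAbs_le_enorm_cesaro {H : ℝ → ℝ} (hH0 : ∀ t, 0 ≤ H t) {x : ℝ} (hx : 0 ≤ x)
    (hint : IntegrableOn H (Ioc 0 x)) : cesaroAbs H x ≤ ‖cesaro H x‖ₑ := by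
  rcases hx.eq_or_lt with rfl | hx0
  · simp [cesaroAbs]
  have h1 : ∫⁻ t in Ioc 0 x, ‖H t‖ₑ = ENNReal.ofReal (∫ t in Ioc 0 x, H t) := by
    rw [← ofReal_integral_norm_eq_lintegral_enorm hint]
    congr 2
    funext t
    rw [Real.norm_of_nonneg (hH0 t)]
  rw [cesaro, intervalIntegral.integral_of_le hx, enorm_mul, cesaroAbs, h1,
    Real.enorm_of_nonneg (by positivity),
    Real.enorm_of_nonneg (integral_nonneg fun t => hH0 t), one_div,
    ENNReal.ofReal_inv_of_pos hx0, div_eq_mul_inv, mul_comm]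

/-- The one place where the hypothesis on `C` is applied. Linear growth of `φ` gives integrability
on each `(0, x]`, so the Bochner integral in `cesaro` is the true one. -/
lemma exists_real_representative (hφ : IsOrlicz φ) (hI : IsUnitOrHalfLine I)
    (hC : ∀ f : ℝ → ℝ, MemOrlicz φ I f → MemOrlicz φ I (cesaro f))
    {h : ℝ → ℝ≥0∞} (hh : Measurable h) (hfin : modular φ I h < ∞) :
    ∃ H : ℝ → ℝ, Measurable H ∧ (∀ᵐ t ∂(volume.restrict I), ‖H t‖ₑ = h t) ∧
      ∃ l : ℝ, 0 < l ∧ modular φ I (fun x => cesaroAbs H x / ENNReal.ofReal l) < ∞ := by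
  have hae : ∀ᵐ t ∂(volume.restrict I), h t < ∞ := by
    filter_upwards [ae_lt_top (hφ.measurable_ext.comp hh) hfin.ne] with t ht
    by_contra ht'
    rw [not_lt_top_iff] at ht'
    simp [ht', ext_top] at ht
  set H : ℝ → ℝ := fun t => (h t).toReal with hH
  have hHm : Measurable H := hh.ennreal_toReal
  have hH0 : ∀ t, 0 ≤ H t := fun t => ENNReal.toReal_nonneg
  have hHle : ∀ t, ‖H t‖ₑ ≤ h t := fun t => by
    rw [Real.enorm_of_nonneg (hH0 t)]
    exact ENNReal.ofReal_toReal_le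
  have hmem : MemOrlicz φ I H := by
    refine ⟨hHm.aestronglyMeasurable, 1, one_pos, lt_of_le_of_lt ?_ hfin⟩
    exact hφ.modular_mono hI.measurableSet fun t _ => by simpa using hHle t
  obtain ⟨-, l, hl, hmod⟩ := hC H hmem
  refine ⟨H, hHm, ?_, l, hl, lt_of_le_of_lt (hφ.modular_mono hI.measurableSet fun x hx => ?_)
    hmod⟩
  · filter_upwards [hae] with t ht
    rw [Real.enorm_of_nonneg (hH0 t), ENNReal.ofReal_toReal ht.ne]
  · refine ENNReal.div_le_div_right (cesaroAbs_le_enorm_cesaro hH0 (hI.nonneg hx)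
      ⟨hHm.aestronglyMeasurable, ?_⟩) _
    obtain ⟨a, b, -, hab⟩ := hφ.exists_le_add_mul
    calc ∫⁻ t in Ioc 0 x, ‖H t‖ₑ
        ≤ ∫⁻ t in Ioc 0 x, ((a : ℝ≥0∞) + b * ext φ (h t)) :=
          lintegral_mono fun t => (hHle t).trans (hab _)
      _ = a * volume (Ioc 0 x) + b * ∫⁻ t in Ioc 0 x, ext φ (h t) := by
          rw [lintegral_add_left measurable_const, lintegral_const_mul' _ _ ENNReal.coe_ne_top]
          simp
      _ ≤ a * volume (Ioc 0 x) + b * modular φ I h := by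
          gcongr
          exact lintegral_mono_set (hI.Ioc_subset hx)
      _ < ∞ := by
          rw [Real.volume_Ioc]
          finiteness

/-- Once `x > 2a`, the interval `(a, x]` fills at least half of `(0, x]`. -/
lemma half_le_cesMean_indicator {a b x : ℝ} (ha : 0 ≤ a) (h2 : 2 * a < x) (hxb : x ≤ b)
    (c : ℝ≥0∞) {g : ℝ → ℝ≥0∞} (hg : ∀ t ∈ Ioc a b, c ≤ g t) : c / 2 ≤ cesMean g x := by
  have hx0 : 0 < x := by linarith
  rw [cesMean, ENNReal.le_div_iff_mul_le (by simp [hx0]) (by simp)]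
  have h3 : ENNReal.ofReal x / 2 ≤ ENNReal.ofReal (x - a) := by
    rw [show (2 : ℝ≥0∞) = ENNReal.ofReal 2 by simp, ← ENNReal.ofReal_div_of_pos two_pos]
    exact ENNReal.ofReal_le_ofReal (by linarith)
  calc c / 2 * ENNReal.ofReal x = c * (ENNReal.ofReal x / 2) := by
        rw [div_eq_mul_inv, div_eq_mul_inv]; ring
    _ ≤ c * ENNReal.ofReal (x - a) := by gcongr
    _ = ∫⁻ t in Ioc a x, c := by simp
    _ ≤ ∫⁻ t in Ioc a x, g t :=
        setLIntegral_mono' measurableSet_Ioc fun t ht => hg t ⟨ht.1, ht.2.trans hxb⟩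
    _ ≤ ∫⁻ t in Ioc 0 x, g t := lintegral_mono_set (Ioc_subset_Ioc_left ha)

/-- The supremum of the functions with value `u n` on `(0, t n]`. -/
noncomputable def stairs (u t : ℕ → ℝ≥0) (s : ℝ) : ℝ≥0∞ :=
  ⨆ n, (Ioc (0 : ℝ) (t n)).indicator (fun _ => (u n : ℝ≥0∞)) s

lemma measurable_stairs (u t : ℕ → ℝ≥0) : Measurable (stairs u t) :=
  Measurable.iSup fun _ => measurable_const.indicator measurableSet_Ioc

lemma le_stairs (u t : ℕ → ℝ≥0) {n : ℕ} {s : ℝ} (hs : s ∈ Ioc (0 : ℝ) (t n)) :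
    (u n : ℝ≥0∞) ≤ stairs u t s :=
  le_iSup_of_le n (by rw [indicator_of_mem hs])

lemma IsOrlicz.modular_stairs_le (hφ : IsOrlicz φ) (u t : ℕ → ℝ≥0) :
    modular φ I (stairs u t) ≤ ∑' n, φ (u n) * t n := by
  have h1 : ∀ s, ext φ (stairs u t s) ≤
      ∑' n, (Ioc (0 : ℝ) (t n)).indicator (fun _ => φ (u n)) s := by
    intro s
    refine (hφ.ext_iSup_le _).trans (iSup_le fun n => le_trans ?_ (ENNReal.le_tsum n))
    by_cases hs : s ∈ Ioc (0 : ℝ) (t n)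
    · rw [indicator_of_mem hs, indicator_of_mem hs, ext_coe]
    · rw [indicator_of_notMem hs, indicator_of_notMem hs, hφ.ext_zero]
  calc modular φ I (stairs u t)
      ≤ ∫⁻ s, ∑' n, (Ioc (0 : ℝ) (t n)).indicator (fun _ => φ (u n)) s :=
        (setLIntegral_le_lintegral _ _).trans (lintegral_mono h1)
    _ = ∑' n, φ (u n) * t n := by
        rw [lintegral_tsum fun n => (measurable_const.indicator measurableSet_Ioc).aemeasurable]
        refine tsum_congr fun n => ?_
        rw [lintegral_indicator measurableSet_Ioc, setLIntegral_const, Real.volume_Ioc]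
        simp

/-- The mean of the `m`-th tail is at least `u n / 2` on `(2a, t n]`, whose length is at least `t n
/ 2` as `4a ≤ t n`. The `2` in `r = (2c)⁻¹` absorbs the first half; the `4` in `hbig` absorbs the
second and leaves modular at least `2`. -/
lemma containsLinfty_of_stairs (hφ : IsOrlicz φ) (hI : IsUnitOrHalfLine I)
    (hC : ∀ f : ℝ → ℝ, MemOrlicz φ I f → MemOrlicz φ I (cesaro f))
    {c : ℝ≥0} (hc : 0 < c) {u t : ℕ → ℝ≥0} (hsum : ∑' n, φ (u n) * t n < ∞)
    (hbig : ∀ n, 4 ≤ φ (c * u n) * t n)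
    {A : ℕ → Set ℝ} (hAm : ∀ n, MeasurableSet (A n))
    (hA : Antitone A) (hAe : ∀ t, ∃ n, t ∉ A n)
    (hex : ∀ m, ∃ n, ∃ a : ℝ, 0 ≤ a ∧ 4 * a ≤ t n ∧ Ioc a (t n) ⊆ A m ∧
      Ioc 0 (t n : ℝ) ⊆ I) :
    ContainsLinfty (Ces φ I) (cesNorm φ I) := by
  obtain ⟨H, hH, hHe, hfin⟩ := exists_real_representative hφ hI hC (measurable_stairs u t)
    ((hφ.modular_stairs_le u t).trans_lt hsum)
  refine containsLinfty_of_tails hφ hI hH hfin hAm hA hAe (r := (2 * c)⁻¹) (by positivity)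
    fun m => ?_
  obtain ⟨n, a, ha, ha4, haA, htI⟩ := hex m
  have hcoe : ENNReal.ofReal ((2 * c : ℝ)⁻¹) = (2 * (c : ℝ≥0∞))⁻¹ := by
    rw [ENNReal.ofReal_inv_of_pos (by positivity), ENNReal.ofReal_mul zero_le_two]
    simp
  have hsub : Ioc (2 * a) (t n : ℝ) ⊆ I :=
    (Ioc_subset_Ioc_left (by positivity)).trans htI
  have hpt : ∀ x ∈ Ioc (2 * a) (t n : ℝ), φ (c * u n) ≤
      ext φ (cesMean ((A m).indicator fun s => ‖H s‖ₑ) x / ENNReal.ofReal (2 * c : ℝ)⁻¹) := by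
    intro x hx
    have h1 : (u n : ℝ≥0∞) / 2 ≤ cesMean ((A m).indicator (stairs u t)) x := by
      refine half_le_cesMean_indicator ha hx.1 hx.2 _ fun s hs => ?_
      rw [indicator_of_mem (haA hs)]
      exact le_stairs u t ⟨ha.trans_lt hs.1, hs.2⟩
    have h2 : cesMean ((A m).indicator (stairs u t)) x =
        cesMean ((A m).indicator fun s => ‖H s‖ₑ) x := by
      refine cesMean_congr_ae hI ?_ (hsub hx)
      filter_upwards [hHe] with s hs
      simp only [indicator, hs]
    rw [← h2, hcoe, ← ext_coe φ]
    refine hφ.ext_mono ?_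
    calc ((c * u n : ℝ≥0) : ℝ≥0∞) = (u n : ℝ≥0∞) / 2 / (2 * (c : ℝ≥0∞))⁻¹ := by
          rw [div_eq_mul_inv _ (2 * (c : ℝ≥0∞))⁻¹, inv_inv, ENNReal.coe_mul, ← mul_assoc,
            ENNReal.div_mul_cancel (by simp) (by simp), mul_comm]
      _ ≤ _ := by gcongr
  calc (1 : ℝ≥0∞) < 2 := by norm_num
    _ ≤ φ (c * u n) * (t n / 2) := by
        rw [← mul_div_assoc, ENNReal.le_div_iff_mul_le (by simp) (by simp)]
        refine le_trans (le_of_eq ?_) (hbig n)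
        norm_num
    _ ≤ φ (c * u n) * volume (Ioc (2 * a) (t n : ℝ)) := by
        gcongr
        rw [Real.volume_Ioc, ← ENNReal.ofReal_coe_nnreal,
          show (2 : ℝ≥0∞) = ENNReal.ofReal 2 by simp, ← ENNReal.ofReal_div_of_pos two_pos]
        exact ENNReal.ofReal_le_ofReal (by linarith)
    _ = ∫⁻ x in Ioc (2 * a) (t n : ℝ), φ (c * u n) := by simp
    _ ≤ ∫⁻ x in Ioc (2 * a) (t n : ℝ), ext φ (cesMean ((A m).indicator fun s => ‖H s‖ₑ) x /
          ENNReal.ofReal (2 * c : ℝ)⁻¹) := setLIntegral_mono' measurableSet_Ioc hpt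
    _ ≤ _ := lintegral_mono_set hsub

lemma containsLinfty_of_stairs_tendsto_zero (hφ : IsOrlicz φ) (hI : IsUnitOrHalfLine I)
    (hC : ∀ f : ℝ → ℝ, MemOrlicz φ I f → MemOrlicz φ I (cesaro f))
    {c : ℝ≥0} (hc : 0 < c) {u t : ℕ → ℝ≥0} (hsum : ∑' n, φ (u n) * t n < ∞)
    (hbig : ∀ n, 4 ≤ φ (c * u n) * t n) (ht : ∀ n, t n ≤ (1 / 2) ^ n) :
    ContainsLinfty (Ces φ I) (cesNorm φ I) := by
  refine containsLinfty_of_stairs hφ hI hC hc hsum hbig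
    (A := fun m : ℕ => Ioc (0 : ℝ) (1 / (m + 1))) (fun _ => measurableSet_Ioc)
    (fun m m' hmm => Ioc_subset_Ioc_right ?_) (fun s => ?_) (fun m => ?_)
  · gcongr
  · rcases le_or_gt s 0 with hs | hs
    · exact ⟨0, fun h => absurd h.1 hs.not_gt⟩
    · obtain ⟨n, hn⟩ := exists_nat_one_div_lt hs
      exact ⟨n, fun h => absurd h.2 (not_le.2 hn)⟩
  · obtain ⟨n, hn⟩ := exists_pow_lt_of_lt_one
      (show (0 : ℝ) < 1 / ((m : ℝ) + 1) by positivity) (show (1 / 2 : ℝ) < 1 by norm_num)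
    have h1 : (t n : ℝ) ≤ (1 / 2) ^ n := by exact_mod_cast ht n
    refine ⟨n, 0, le_rfl, by simp, Ioc_subset_Ioc_right (h1.trans hn.le), ?_⟩
    refine (Ioc_subset_Ioc_right ?_).trans (hI.Ioc_subset hI.one_mem)
    exact h1.trans (pow_le_one₀ (by norm_num) (by norm_num))

lemma containsLinfty_of_stairs_tendsto_atTop (hφ : IsOrlicz φ)
    (hC : ∀ f : ℝ → ℝ, MemOrlicz φ (Ici 0) f → MemOrlicz φ (Ici 0) (cesaro f))
    {c : ℝ≥0} (hc : 0 < c) {u t : ℕ → ℝ≥0} (hsum : ∑' n, φ (u n) * t n < ∞)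
    (hbig : ∀ n, 4 ≤ φ (c * u n) * t n) (ht : ∀ n : ℕ, (n : ℝ≥0) ≤ t n) :
    ContainsLinfty (Ces φ (Ici 0)) (cesNorm φ (Ici 0)) := by
  refine containsLinfty_of_stairs hφ (Or.inr rfl) hC hc hsum hbig
    (A := fun m : ℕ => Ioi (m : ℝ)) (fun _ => measurableSet_Ioi)
    (fun m m' hmm => Ioi_subset_Ioi (by exact_mod_cast hmm)) (fun s => ?_) (fun m => ?_)
  · obtain ⟨n, hn⟩ := exists_nat_ge s
    exact ⟨n, not_lt.2 hn⟩
  · have h1 : ((4 * m : ℕ) : ℝ) ≤ t (4 * m) := by exact_mod_cast ht (4 * m)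
    -- The index `4 * m` gives `4a ≤ t n` with `a = m`.
    refine ⟨4 * m, m, m.cast_nonneg, by simpa using h1, Ioc_subset_Ioi_self, fun s hs => ?_⟩
    exact hs.1.le

end Construction

/-! ### Heights and lengths when `Δ₂` fails -/

section NotDelta2

lemma tsum_two_inv_pow_lt_top : ∑' n : ℕ, (((1 / 2 : ℝ≥0) ^ n : ℝ≥0) : ℝ≥0∞) < ∞ := by
  have : Summable fun n : ℕ => (1 / 2 : ℝ≥0) ^ n :=
    NNReal.summable_geometric (by rw [div_lt_one two_pos]; exact one_lt_two)
  exact (ENNReal.tsum_coe_ne_top_iff_summable.2 this).lt_top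

lemma mul_div_cancel_of_pos {v : ℝ≥0∞} (h0 : v ≠ 0) (hv : v ≠ ∞) (r : ℝ≥0) :
    v * ((r / v.toNNReal : ℝ≥0) : ℝ≥0∞) = r := by
  lift v to ℝ≥0 using hv
  have h0' : v ≠ 0 := by exact_mod_cast h0
  rw [ENNReal.toNNReal_coe, ← ENNReal.coe_mul, mul_div_cancel₀ _ h0']

/-- A choice of lengths for a sequence witnessing the failure of `Δ₂`. -/
lemma exists_lengths {u : ℕ → ℝ≥0} (h0 : ∀ n, φ (u n) ≠ 0) (hfin : ∀ n, φ (u n) ≠ ∞)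
    (hu : ∀ n : ℕ, (4 * 2 ^ n : ℝ≥0) * φ (u n) ≤ φ (2 * u n)) :
    ∃ t : ℕ → ℝ≥0, (∀ n, φ (u n) * t n = ((1 / 2 : ℝ≥0) ^ n : ℝ≥0)) ∧
      ∀ n, 4 ≤ φ (2 * u n) * t n := by
  have key : ∀ n, φ (u n) * (((1 / 2 : ℝ≥0) ^ n / (φ (u n)).toNNReal : ℝ≥0) : ℝ≥0∞) =
      ((1 / 2 : ℝ≥0) ^ n : ℝ≥0) := fun n => mul_div_cancel_of_pos (h0 n) (hfin n) _
  refine ⟨_, key, fun n => ?_⟩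
  refine le_trans (le_of_eq ?_) (mul_le_mul_left (hu n) _)
  rw [mul_assoc, key, ← ENNReal.coe_mul, mul_assoc, ← mul_pow]
  norm_num

/-- A constant height `u` with `φ u` finite suffices: `c = v / u` lifts it to where `φ` is infinite.
-/
lemma containsLinfty_of_eq_top (hφ : IsOrlicz φ) (hI : IsUnitOrHalfLine I)
    (hC : ∀ f : ℝ → ℝ, MemOrlicz φ I f → MemOrlicz φ I (cesaro f))
    (h : ∃ v, φ v = ∞) : ContainsLinfty (Ces φ I) (cesNorm φ I) := by
  obtain ⟨v, hv⟩ := h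
  obtain ⟨u, hu, hφu⟩ := hφ.not_top
  have hv0 : 0 < v := by
    rcases eq_or_ne v 0 with rfl | h
    · simp [hφ.map_zero] at hv
    · exact pos_iff_ne_zero.2 h
  refine containsLinfty_of_stairs_tendsto_zero hφ hI hC (c := v / u) (by positivity)
    (u := fun _ => u) (t := fun n => (1 / 2) ^ n) ?_ (fun n => ?_) (fun n => le_rfl)
  · rw [ENNReal.tsum_mul_left]
    exact ENNReal.mul_lt_top hφu.lt_top tsum_two_inv_pow_lt_top
  · rw [div_mul_cancel₀ _ hu.ne', hv, ENNReal.top_mul]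
    · exact le_top
    · have : ((1 / 2 : ℝ≥0) ^ n) ≠ 0 := by positivity
      exact_mod_cast this

lemma IsOrlicz.exists_le_map (hφ : IsOrlicz φ) (r : ℝ≥0) : ∃ u, 0 < u ∧ (r : ℝ≥0∞) ≤ φ u := by
  obtain ⟨a, b, hb, hab⟩ := hφ.exists_le_add_mul
  refine ⟨a + b * r + 1, by positivity, ?_⟩
  by_contra! hlt
  have h1 := hab ((a + b * r + 1 : ℝ≥0) : ℝ≥0∞)
  rw [ext_coe] at h1
  have h2 : ((a + b * r + 1 : ℝ≥0) : ℝ≥0∞) ≤ ((a + b * r : ℝ≥0) : ℝ≥0∞) := by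
    refine h1.trans ?_
    push_cast
    gcongr
  have h3 : a + b * r + 1 ≤ a + b * r := by exact_mod_cast h2
  exact absurd h3 (not_le.2 (lt_add_one _))

lemma containsLinfty_of_not_delta2Infty (hφ : IsOrlicz φ) (hI : IsUnitOrHalfLine I)
    (hC : ∀ f : ℝ → ℝ, MemOrlicz φ I f → MemOrlicz φ I (cesaro f))
    (h : ¬ Delta2Infty φ) : ContainsLinfty (Ces φ I) (cesNorm φ I) := by
  by_cases htop : ∃ v, φ v = ∞
  · exact containsLinfty_of_eq_top hφ hI hC htop
  push Not at htop
  -- Heights with `φ (u n) ≥ 1` force `t n ≤ 2⁻ⁿ`, so the steps shrink to `0`.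
  obtain ⟨u₀, hu₀, h1⟩ := hφ.exists_le_map 1
  rw [ENNReal.coe_one] at h1
  have hex : ∀ n : ℕ, ∃ u, u₀ ≤ u ∧ (4 * 2 ^ n : ℝ≥0) * φ u < φ (2 * u) := by
    intro n
    by_contra! hcon
    exact h ⟨4 * 2 ^ n, u₀, by positivity, hu₀, (htop _).lt_top, hcon⟩
  choose u hu hlt using hex
  have hone : ∀ n, 1 ≤ φ (u n) := fun n => h1.trans (hφ.mono (hu n))
  obtain ⟨t, ht, hbig⟩ := exists_lengths (fun n => (one_pos.trans_le (hone n)).ne')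
    (fun n => htop _) (fun n => (hlt n).le)
  refine containsLinfty_of_stairs_tendsto_zero hφ hI hC two_pos (u := u) (t := t) ?_ hbig
    (fun n => ?_)
  · simp_rw [ht]
    exact tsum_two_inv_pow_lt_top
  · have : (t n : ℝ≥0∞) ≤ ((1 / 2 : ℝ≥0) ^ n : ℝ≥0) := by
      rw [← ht n]
      exact le_mul_of_one_le_left' (hone n)
    exact_mod_cast this

/-- A height at which `φ` vanishes has modular zero on any length, so the lengths may grow freely.
-/
lemma containsLinfty_of_eq_zero (hφ : IsOrlicz φ)
    (hC : ∀ f : ℝ → ℝ, MemOrlicz φ (Ici 0) f → MemOrlicz φ (Ici 0) (cesaro f))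
    (h : ∃ u, 0 < u ∧ φ u = 0) : ContainsLinfty (Ces φ (Ici 0)) (cesNorm φ (Ici 0)) := by
  obtain ⟨u, hu, hφu⟩ := h
  obtain ⟨v, hv, hφv⟩ := hφ.exists_le_map 4
  refine containsLinfty_of_stairs_tendsto_atTop hφ hC (c := v / u) (by positivity)
    (u := fun _ => u) (t := fun n => n + 1) ?_ (fun n => ?_) (fun n => by simp)
  · simp [hφu]
  · rw [div_mul_cancel₀ _ hu.ne']
    calc (4 : ℝ≥0∞) = 4 * 1 := by simp
      _ ≤ φ v * ((n + 1 : ℝ≥0) : ℝ≥0∞) := by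
        gcongr
        · simpa using hφv
        · simp

lemma containsLinfty_of_not_delta2_near_zero (hφ : IsOrlicz φ)
    (hC : ∀ f : ℝ → ℝ, MemOrlicz φ (Ici 0) f → MemOrlicz φ (Ici 0) (cesaro f))
    (hpos : ∀ u, 0 < u → φ u ≠ 0) (hfin : ∀ u, φ u ≠ ∞)
    (h : ∀ (K u₁ : ℝ≥0), 0 < u₁ → ∃ u ≤ u₁, K * φ u < φ (2 * u)) :
    ContainsLinfty (Ces φ (Ici 0)) (cesNorm φ (Ici 0)) := by
  -- Since `φ (u n) * t n = 2⁻ⁿ`, the bound `φ (u n) ≤ 4⁻ⁿ` gives `t n ≥ 2ⁿ`.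
  have hsmall : ∀ n : ℕ, ∃ u₁ : ℝ≥0, 0 < u₁ ∧ φ u₁ ≤ ((1 / 4 : ℝ≥0) ^ n : ℝ≥0) := by
    intro n
    have h0 : (0 : ℝ≥0∞) < ((1 / 4 : ℝ≥0) ^ n : ℝ≥0) := by
      have : 0 < (1 / 4 : ℝ≥0) ^ n := by positivity
      exact_mod_cast this
    obtain ⟨v, hv, hv1⟩ := ENNReal.nhds_zero_basis_Iic.mem_iff.1
      (hφ.tendsto_ext_zero (Iic_mem_nhds h0))
    obtain ⟨w, hw0, hwv⟩ := ENNReal.lt_iff_exists_nnreal_btwn.1 hv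
    refine ⟨w, by exact_mod_cast hw0, ?_⟩
    have := hv1 (show (w : ℝ≥0∞) ∈ Iic v from hwv.le)
    simpa only [mem_preimage, ext_coe, mem_Iic] using this
  choose δ hδ0 hδ using hsmall
  choose u hu hlt using fun n : ℕ => h (4 * 2 ^ n) (δ n) (hδ0 n)
  have hu0 : ∀ n, 0 < u n := by
    intro n
    rcases eq_or_ne (u n) 0 with h0 | h0
    · have := hlt n
      simp [h0, hφ.map_zero] at this
    · exact pos_iff_ne_zero.2 h0
  obtain ⟨t, ht, hbig⟩ := exists_lengths (fun n => hpos _ (hu0 n)) (fun n => hfin _)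
    (fun n => (hlt n).le)
  refine containsLinfty_of_stairs_tendsto_atTop hφ hC two_pos (u := u) (t := t) ?_ hbig
    (fun n => ?_)
  · simp_rw [ht]
    exact tsum_two_inv_pow_lt_top
  · have h1 : ((1 / 2 : ℝ≥0) ^ n : ℝ≥0) ≤ (((1 / 4 : ℝ≥0) ^ n : ℝ≥0) : ℝ≥0∞) * t n := by
      rw [← ht n]
      gcongr
      exact (hφ.mono (hu n)).trans (hδ n)
    have h2 : (1 / 2 : ℝ≥0) ^ n ≤ (1 / 4 : ℝ≥0) ^ n * t n := by exact_mod_cast h1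
    have h3 : (2 : ℝ≥0) ^ n ≤ t n := by
      have e1 : (1 / 2 : ℝ≥0) ^ n = (1 / 4) ^ n * 2 ^ n := by
        rw [← mul_pow]; congr 1; norm_num
      rw [e1] at h2
      exact le_of_mul_le_mul_left h2 (by positivity)
    exact le_trans (by exact_mod_cast Nat.lt_two_pow_self.le) h3

/-- Between `u₁` and `u₀` monotonicity bounds `φ (2 * u) / φ u` by `φ (2 * u₀) / φ u₁`. -/
lemma delta2All_of_delta2Infty (hφ : IsOrlicz φ) (hpos : ∀ u, 0 < u → φ u ≠ 0)
    (hfin : ∀ u, φ u ≠ ∞) (h : Delta2Infty φ)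
    (h0 : ∃ K u₁ : ℝ≥0, 0 < u₁ ∧ ∀ u ≤ u₁, φ (2 * u) ≤ K * φ u) : Delta2All φ := by
  obtain ⟨K, u₀, hK, -, -, hinf⟩ := h
  obtain ⟨L, u₁, hu₁, hzero⟩ := h0
  set m : ℝ≥0 := (φ (2 * u₀)).toNNReal / (φ u₁).toNNReal with hm
  refine ⟨K + L + m, by positivity, fun u => ?_⟩
  push_cast
  rw [add_mul, add_mul]
  rcases le_total u₀ u with h1 | h1
  · exact (hinf u h1).trans ((le_add_right le_rfl).trans (le_add_right le_rfl))
  rcases le_total u u₁ with h2 | h2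
  · exact (hzero u h2).trans ((le_add_left le_rfl).trans (le_add_right le_rfl))
  refine le_add_left ?_
  calc φ (2 * u) ≤ φ (2 * u₀) := hφ.mono (by gcongr)
    _ = φ u₁ * m := by
        rw [hm, mul_div_cancel_of_pos (hpos _ hu₁) (hfin _), ENNReal.coe_toNNReal (hfin _)]
    _ ≤ φ u * m := by gcongr; exact hφ.mono h2
    _ = m * φ u := mul_comm _ _

lemma containsLinfty_of_not_delta2All (hφ : IsOrlicz φ)
    (hC : ∀ f : ℝ → ℝ, MemOrlicz φ (Ici 0) f → MemOrlicz φ (Ici 0) (cesaro f))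
    (h : ¬ Delta2All φ) : ContainsLinfty (Ces φ (Ici 0)) (cesNorm φ (Ici 0)) := by
  by_cases htop : ∃ v, φ v = ∞
  · exact containsLinfty_of_eq_top hφ (Or.inr rfl) hC htop
  by_cases hzero : ∃ u, 0 < u ∧ φ u = 0
  · exact containsLinfty_of_eq_zero hφ hC hzero
  push Not at htop hzero
  by_cases hinf : Delta2Infty φ
  · refine containsLinfty_of_not_delta2_near_zero hφ hC hzero htop fun K u₁ hu₁ => ?_
    by_contra! hcon
    exact h (delta2All_of_delta2Infty hφ hzero htop hinf ⟨K, u₁, hu₁, hcon⟩)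
  · exact containsLinfty_of_not_delta2Infty hφ (Or.inr rfl) hC hinf

end NotDelta2

end CesaroOrlicz

theorem theorem7 (φ : ℝ≥0 → ℝ≥0∞) (hφ : CesaroOrlicz.IsOrlicz φ) :
    ((∀ f : ℝ → ℝ, CesaroOrlicz.MemOrlicz φ (Icc 0 1) f →
        CesaroOrlicz.MemOrlicz φ (Icc 0 1) (CesaroOrlicz.cesaro f)) →
      List.TFAE [
        CesaroOrlicz.Delta2Infty φ,
        CesaroOrlicz.IsOrderContinuous (CesaroOrlicz.Ces φ (Icc 0 1))
          (CesaroOrlicz.cesNorm φ (Icc 0 1)),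
        ¬ CesaroOrlicz.ContainsLinfty (CesaroOrlicz.Ces φ (Icc 0 1))
          (CesaroOrlicz.cesNorm φ (Icc 0 1))]) ∧
    ((∀ f : ℝ → ℝ, CesaroOrlicz.MemOrlicz φ (Ici 0) f →
        CesaroOrlicz.MemOrlicz φ (Ici 0) (CesaroOrlicz.cesaro f)) →
      List.TFAE [
        CesaroOrlicz.Delta2All φ,
        CesaroOrlicz.IsOrderContinuous (CesaroOrlicz.Ces φ (Ici 0))
          (CesaroOrlicz.cesNorm φ (Ici 0)),
        ¬ CesaroOrlicz.ContainsLinfty (CesaroOrlicz.Ces φ (Ici 0))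
          (CesaroOrlicz.cesNorm φ (Ici 0))]) := by
  constructor
  · intro hC
    tfae_have 1 → 2 := fun h =>
      CesaroOrlicz.IsUnitOrHalfLine.isOrderContinuous (Or.inl rfl) hφ (h.delta2On hφ)
    tfae_have 2 → 3 := CesaroOrlicz.IsUnitOrHalfLine.not_containsLinfty (Or.inl rfl) hφ
    tfae_have 3 → 1 := fun h => by
      by_contra hcon
      exact h (CesaroOrlicz.containsLinfty_of_not_delta2Infty hφ (Or.inl rfl) hC hcon)
    tfae_finish
  · intro hC
    tfae_have 1 → 2 := fun h =>
      CesaroOrlicz.IsUnitOrHalfLine.isOrderContinuous (Or.inr rfl) hφ h.delta2On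
    tfae_have 2 → 3 := CesaroOrlicz.IsUnitOrHalfLine.not_containsLinfty (Or.inr rfl) hφ
    tfae_have 3 → 1 := fun h => by
      by_contra hcon
      exact h (CesaroOrlicz.containsLinfty_of_not_delta2All hφ hC hcon)
    tfae_finish
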